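/- Let $\delta\in\mathbb C$ and let $\phi$ be a meromorphic function in a neighbourhood of the origin with the local expression $$\phi(z)=\frac{1-\delta^2}{2z^2}+\frac{a_1}{z}+a_2+a_3z+\cdots\qquad (z\to 0).$$ Let $U=\{0<|z|<R\}$ be a punctured disk on which $\phi$ is holomorphic, and let $z_0\in U$. Then there is a holomorphic map $f_0$ from a neighbourhood of $z_0$ to $\widehat{\mathbb C}=\mathbb C\cup\{\infty\}$ whose Schwarzian derivative $S_{f_0}=\frac{f_0'''}{f_0'}-\frac32\big(\frac{f_0''}{f_0'}\big)^2$ is $\phi$. For every such $f_0$ and every loop $p$ in $U$ based at $z_0$, the germ of $f_0$ at $z_0$ can be continued analytically along $p$ (as a germ with values in $\widehat{\mathbb C}$), and the germ at the end of the continuation is $\gamma_p\circ f_0$ for a unique Möbius transformation $\gamma_p$. Let $\gamma_\phi$ be the transformation $\gamma_p$ for the loop $p(t)=z_0e^{2\pi i t}$, $0\le t\le1$. Then $\{\gamma_p\}$, over all loops $p$ in $U$ based at $z_0$, is the cyclic group generated by $\gamma_\phi$ (the holonomy group of the projective structure on $U$ induced by $\phi$), and: (a) if $\delta$ is not an integer,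 $\gamma_\phi$ is not the identity and is conjugate, in the Möbius group, to $w\mapsto e^{2\pi i\delta}w$; it is elliptic (conjugate to $w\mapsto\lambda w$ with $|\lambda|=1$, $\lambda\neq1$) if and only if $\delta$ is real, and loxodromic (conjugate to $w\mapsto\lambda w$ with $|\lambda|\ne1$) if and only if $\delta$ is not real; (b) if $\delta=0$, $\gamma_\phi$ is parabolic (conjugate to $w\mapsto w+1$); (c) if $\delta=\pm d$ with an integer $d\ge1$, $\gamma_\phi$ is parabolic or the identity, and it is the identity if and only if $$\det\begin{pmatrix} a_1&k_1&0&\cdots&0\\ a_2&a_1&k_2&\cdots&0\\ \vdots&\vdots&\vdots&&\vdots\\ a_{d-1}&a_{d-2}&a_{d-3}&\cdots&k_{d-1}\\ a_d&a_{d-1}&a_{d-2}&\cdots&a_1\end{pmatrix}=0,\qquad k_j=2j(j-d),\quad j=1,\dots,d-1.$$ -/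

import Mathlib

open Filter Topology Complex

/-- The Möbius group of the Riemann sphere `ℂ ∪ {∞}`: all permutations of the sphere of the form
`z ↦ (a z + b) / (c z + d)` with `a d - b c ≠ 0`. -/
noncomputable def moebiusGroup : Subgroup (Equiv.Perm (OnePoint ℂ)) :=
  (MulAction.toPermHom (GL (Fin 2) ℂ) (OnePoint ℂ)).range

/-- `γ` is conjugate, in the Möbius group, to `z ↦ lam * z`. (This forces `lam ≠ 0`.) -/
def IsConjToScaling (γ : moebiusGroup) (lam : ℂ) : Prop :=
  ∃ h : moebiusGroup, ∀ z : ℂ,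
    ((h * γ * h⁻¹ : moebiusGroup) : Equiv.Perm (OnePoint ℂ)) (z : OnePoint ℂ)
      = ((lam * z : ℂ) : OnePoint ℂ)

/-- Elliptic: conjugate to a non-trivial rotation. -/
def IsEllipticMoebius (γ : moebiusGroup) : Prop :=
  ∃ lam : ℂ, ‖lam‖ = 1 ∧ lam ≠ 1 ∧ IsConjToScaling γ lam

/-- Loxodromic (hyperbolic in the wide sense): conjugate to `z ↦ lam * z` with `|lam| ≠ 1`. -/
def IsLoxodromicMoebius (γ : moebiusGroup) : Prop :=
  ∃ lam : ℂ, ‖lam‖ ≠ 1 ∧ IsConjToScaling γ lam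

/-- Parabolic: conjugate to `z ↦ z + 1`. -/
def IsParabolicMoebius (γ : moebiusGroup) : Prop :=
  ∃ h : moebiusGroup, ∀ z : ℂ,
    ((h * γ * h⁻¹ : moebiusGroup) : Equiv.Perm (OnePoint ℂ)) (z : OnePoint ℂ)
      = ((z + 1 : ℂ) : OnePoint ℂ)

open Classical in
/-- `f`, with values in the Riemann sphere, is holomorphic near `z₀`: near `z₀` either `f` is a
finite-valued holomorphic function, or `1 / f` is one that vanishes at `z₀`. -/
def HolomorphicToSphereAt (f : ℂ → OnePoint ℂ) (z₀ : ℂ) : Prop :=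
  (∃ g : ℂ → ℂ, AnalyticAt ℂ g z₀ ∧ ∀ᶠ w in 𝓝 z₀, f w = (g w : OnePoint ℂ)) ∨
  (∃ g : ℂ → ℂ, AnalyticAt ℂ g z₀ ∧ g z₀ = 0 ∧
    ∀ᶠ w in 𝓝 z₀, f w = if g w = 0 then OnePoint.infty else (((g w)⁻¹ : ℂ) : OnePoint ℂ))

/-- The finite values of a sphere-valued function (with value `0` put in at the poles). -/
noncomputable def finitePart (f : ℂ → OnePoint ℂ) (w : ℂ) : ℂ := (f w).elim 0 id

/-- The Schwarzian derivative `f''' / f' - (3/2) (f'' / f')²` of a complex-valued function. -/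
noncomputable def schwarzian (f : ℂ → ℂ) (z : ℂ) : ℂ :=
  iteratedDeriv 3 f z / deriv f z - 3 / 2 * (iteratedDeriv 2 f z / deriv f z) ^ 2

/-- `f` is, near `z₀`, a sphere-valued holomorphic non-constant solution of `S_f = φ`. The
equation is asked for in a punctured neighbourhood of `z₀`, where `f` has no poles and no critical
points; at `z₀` itself the Schwarzian of `f` is defined, at a pole, by passing to the limit. -/
def IsSchwarzianPrimitiveAt (φ : ℂ → ℂ) (f : ℂ → OnePoint ℂ) (z₀ : ℂ) : Prop :=
  HolomorphicToSphereAt f z₀ ∧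
  ∀ᶠ w in 𝓝[≠] z₀, f w ≠ OnePoint.infty ∧ deriv (finitePart f) w ≠ 0 ∧
    schwarzian (finitePart f) w = φ w

/-- `F t`, for `0 ≤ t ≤ 1`, is an analytic continuation along the path `p`: `F t` is a holomorphic
function element at `p t`, and for `s` near `t` the germs of `F s` and `F t` at `p s` agree. -/
def IsContinuationAlong {z₀ z₁ : ℂ} (p : Path z₀ z₁) (F : unitInterval → ℂ → OnePoint ℂ) : Prop :=
  ∀ t, HolomorphicToSphereAt (F t) (p t) ∧ ∀ᶠ s in 𝓝 t, F s =ᶠ[𝓝 (p s)] F t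

/-- `γ` is the holonomy along the loop `p` of the function element `f₀`: the continuation of `f₀`
along `p` exists and ends with the element `γ ∘ f₀`. -/
def IsHolonomyAlong {z₀ : ℂ} (f₀ : ℂ → OnePoint ℂ) (p : Path z₀ z₀) (γ : moebiusGroup) : Prop :=
  ∃ F : unitInterval → ℂ → OnePoint ℂ, IsContinuationAlong p F ∧ F 0 =ᶠ[𝓝 z₀] f₀ ∧
    F 1 =ᶠ[𝓝 z₀] fun w => (γ : Equiv.Perm (OnePoint ℂ)) (f₀ w)

/-- All holonomies of the function element `f₀` at `z₀` along loops in `U` based at `z₀`. -/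
def holonomySet (U : Set ℂ) (z₀ : ℂ) (f₀ : ℂ → OnePoint ℂ) : Set moebiusGroup :=
  {γ | ∃ p : Path z₀ z₀, (∀ t, p t ∈ U) ∧ IsHolonomyAlong f₀ p γ}

/-- The loop `t ↦ z₀ e^{2 π i t}`, once around the origin. -/
noncomputable def circleLoop (z₀ : ℂ) : Path z₀ z₀ where
  toFun t := z₀ * exp (2 * Real.pi * I * ((t : ℝ) : ℂ))
  continuous_toFun := by fun_prop
  source' := by simp
  target' := by simp [Complex.exp_two_pi_mul_I]

/-- The punctured disk `{0 < |z| < R}`. -/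
def puncturedDisk (R : ℝ) : Set ℂ := {z | 0 < ‖z‖ ∧ ‖z‖ < R}

/-- The `d × d` matrix with entries `a_{i-j+1}` on and below the diagonal, `k_i = 2 i (i - d)` at
place `(i, i+1)`, and `0` elsewhere (rows and columns numbered from `1`; in `Fin d` from `0`). -/
def coeffMatrix (a : ℕ → ℂ) (d : ℕ) : Matrix (Fin d) (Fin d) ℂ :=
  Matrix.of fun i j =>
    if (j : ℕ) ≤ i then a ((i : ℕ) - j + 1)
    else if (j : ℕ) = i + 1 then 2 * ((i : ℂ) + 1) * ((i : ℂ) + 1 - d)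
    else 0

/-! The Schwarzian equation is linearised: the quotient of two independent solutions of u'' + (φ/2)
u = 0 has Schwarzian φ, and every sphere-valued solution is a Möbius transform of such a quotient
(`IsSchwarzianPrimitiveAt.eq_smul`). With z = exp ζ and u = exp (ζ/2) v the equation becomes v'' =
(1/4 - z²φ/2) v = (δ²/4 - ∑ (a n / 2) zⁿ) v. The factor exp (ζ/2) absorbs the first-order term that
the substitution creates. Solutions are now single-valued on the half-plane Re ζ < log R, the
potential has period 2πi, and v₂/v₁ changes by a Möbius map M under ζ ↦ ζ + 2πi. A loop in U lifts
through exp to a path with increment 2πin, so its holonomy is a conjugate of Mⁿ, by the same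
conjugation for all loops (`IsDevelopingPair.holonomy`). Everything reduces to finding one explicit
pair and its M.

The pair comes from the Frobenius method. A series z^s ∑ c n zⁿ is a solution when s² = δ²/4 and n(n
+ 2s) c n + ∑_{i<n} c i b(n-i) = 0, where b n = a n / 2 for n ≥ 1. If δ is not an integer, both
exponents ±δ/2 work; the quotient is z^δ times a single-valued function and M is w ↦ exp(2πiδ) w. If
δ = ±d, the exponent d/2 works, but for -d/2 the factor n(n - d) vanishes at n = d. The obstruction
S = ∑_{i<d} k i b(d-i) is compensated by a term A log z · v₁ with A = -S/d, and M is the translation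
by 2πiA. For d = 0 the exponents coincide and the logarithm is always present.

The rows of `coeffMatrix` are twice the recursion at n = 1, …, d, the last being the obstruction.
Hence its determinant vanishes exactly when S = 0 (`coeffMatrix_det_eq_zero_iff`), that is, when M
is the identity. -/

/-! ### Homogeneous coordinates and the identity theorem on the sphere -/

/-- The point of the Riemann sphere with homogeneous coordinates `[P : Q]`. -/
noncomputable def toSphere (P Q : ℂ) : OnePoint ℂ :=
  if Q = 0 then OnePoint.infty else ((P / Q : ℂ) : OnePoint ℂ)

lemma toSphere_of_ne {P Q : ℂ} (h : Q ≠ 0) : toSphere P Q = ((P / Q : ℂ) : OnePoint ℂ) := if_neg h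

lemma toSphere_one (x : ℂ) : toSphere x 1 = (x : OnePoint ℂ) := by simp [toSphere]

/-- The pairs must be nonzero because `toSphere 0 0` is ∞ by convention. -/
lemma toSphere_eq_iff {P Q P' Q' : ℂ} (h : P ≠ 0 ∨ Q ≠ 0) (h' : P' ≠ 0 ∨ Q' ≠ 0) :
    toSphere P Q = toSphere P' Q' ↔ P * Q' = P' * Q := by
  unfold toSphere
  by_cases hQ : Q = 0 <;> by_cases hQ' : Q' = 0
  · simp [hQ, hQ']
  · have hP : P ≠ 0 := by simpa [hQ] using h
    simp [hQ, hQ', hP]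
  · have hP : P' ≠ 0 := by simpa [hQ'] using h'
    simp [hQ, hQ', hP]
  · simp [hQ, hQ', div_eq_div_iff]

lemma smul_toSphere (g : GL (Fin 2) ℂ) {P Q : ℂ} (h : P ≠ 0 ∨ Q ≠ 0) :
    g • toSphere P Q = toSphere (g 0 0 * P + g 0 1 * Q) (g 1 0 * P + g 1 1 * Q) := by
  unfold toSphere
  by_cases hQ : Q = 0
  · have hP : P ≠ 0 := by simpa [hQ] using h
    simp only [hQ, if_true, OnePoint.smul_infty_eq_ite]
    by_cases hc : g 1 0 = 0
    · simp [hc]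
    · simp [hc, hP, mul_div_mul_right]
  · simp only [hQ, if_false, OnePoint.smul_some_eq_ite]
    have e : g 1 0 * (P / Q) + g 1 1 = (g 1 0 * P + g 1 1 * Q) / Q := by field_simp
    have e' : g 0 0 * (P / Q) + g 0 1 = (g 0 0 * P + g 0 1 * Q) / Q := by field_simp
    rw [e, e']
    by_cases h0 : g 1 0 * P + g 1 1 * Q = 0
    · simp [h0]
    · have : (g 1 0 * P + g 1 1 * Q) / Q ≠ 0 := div_ne_zero h0 hQ
      rw [if_neg this, if_neg h0, div_div_div_cancel_right₀ hQ]

lemma gl_det_ne_zero (g : GL (Fin 2) ℂ) : g 0 0 * g 1 1 - g 0 1 * g 1 0 ≠ 0 := by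
  have := g.det_ne_zero
  rwa [Matrix.det_fin_two] at this

lemma smul_coords_ne_zero (g : GL (Fin 2) ℂ) {P Q : ℂ} (h : P ≠ 0 ∨ Q ≠ 0) :
    g 0 0 * P + g 0 1 * Q ≠ 0 ∨ g 1 0 * P + g 1 1 * Q ≠ 0 := by
  by_contra! hc
  have hd := gl_det_ne_zero g
  have h1 : (g 0 0 * g 1 1 - g 0 1 * g 1 0) * P = 0 := by
    linear_combination g 1 1 * hc.1 - g 0 1 * hc.2
  have h2 : (g 0 0 * g 1 1 - g 0 1 * g 1 0) * Q = 0 := by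
    linear_combination g 0 0 * hc.2 - g 1 0 * hc.1
  simp_all

/-- Near `z`, the sphere-valued `f` is `[P : Q]` with holomorphic `P`, `Q` without common zeros. -/
def HasSphereCoords (f : ℂ → OnePoint ℂ) (P Q : ℂ → ℂ) (z : ℂ) : Prop :=
  AnalyticAt ℂ P z ∧ AnalyticAt ℂ Q z ∧ (P z ≠ 0 ∨ Q z ≠ 0) ∧
    ∀ᶠ w in 𝓝 z, f w = toSphere (P w) (Q w)

lemma HasSphereCoords.holomorphic {f : ℂ → OnePoint ℂ} {P Q : ℂ → ℂ} {z : ℂ}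
    (h : HasSphereCoords f P Q z) : HolomorphicToSphereAt f z := by
  obtain ⟨hP, hQ, h0, hf⟩ := h
  by_cases hQz : Q z = 0
  · have hPz : P z ≠ 0 := by simpa [hQz] using h0
    refine Or.inr ⟨fun w => Q w / P w, hQ.div hP hPz, by simp [hQz], ?_⟩
    filter_upwards [hf, hP.continuousAt.eventually_ne hPz] with w hw hPw
    rw [hw, toSphere]
    by_cases hQw : Q w = 0 <;> simp [hQw, hPw]
  · refine Or.inl ⟨fun w => P w / Q w, hP.div hQ hQz, ?_⟩
    filter_upwards [hf, hQ.continuousAt.eventually_ne hQz] with w hw hQw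
    rw [hw, toSphere_of_ne hQw]

/-- With [g : 1] in the finite case and [1 : g] at a pole, poles need no separate treatment
afterwards. -/
lemma HolomorphicToSphereAt.exists_coords {f : ℂ → OnePoint ℂ} {z : ℂ}
    (h : HolomorphicToSphereAt f z) : ∃ P Q : ℂ → ℂ, HasSphereCoords f P Q z := by
  rcases h with ⟨g, hg, hf⟩ | ⟨g, hg, -, hf⟩
  · refine ⟨g, fun _ => 1, hg, analyticAt_const, by simp, ?_⟩
    filter_upwards [hf] with w hw
    rw [hw, toSphere_one]
  · refine ⟨fun _ => 1, g, analyticAt_const, hg, by simp, ?_⟩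
    filter_upwards [hf] with w hw
    rw [hw, toSphere]
    by_cases h : g w = 0 <;> simp [h]

lemma HasSphereCoords.smul {f : ℂ → OnePoint ℂ} {P Q : ℂ → ℂ} {z : ℂ}
    (h : HasSphereCoords f P Q z) (g : GL (Fin 2) ℂ) :
    HasSphereCoords (fun w => g • f w) (fun w => g 0 0 * P w + g 0 1 * Q w)
      (fun w => g 1 0 * P w + g 1 1 * Q w) z := by
  obtain ⟨hP, hQ, h0, hf⟩ := h
  refine ⟨(analyticAt_const.mul hP).add (analyticAt_const.mul hQ),
    (analyticAt_const.mul hP).add (analyticAt_const.mul hQ), smul_coords_ne_zero g h0, ?_⟩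
  have hne : ∀ᶠ w in 𝓝 z, P w ≠ 0 ∨ Q w ≠ 0 := by
    rcases h0 with h0 | h0
    · exact (hP.continuousAt.eventually_ne h0).mono fun _ => Or.inl
    · exact (hQ.continuousAt.eventually_ne h0).mono fun _ => Or.inr
  filter_upwards [hf, hne] with w hw hn
  rw [hw, smul_toSphere g hn]

lemma HolomorphicToSphereAt.smul {f : ℂ → OnePoint ℂ} {z : ℂ} (h : HolomorphicToSphereAt f z)
    (g : GL (Fin 2) ℂ) : HolomorphicToSphereAt (fun w => g • f w) z := by
  obtain ⟨P, Q, hPQ⟩ := h.exists_coords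
  exact (hPQ.smul g).holomorphic

lemma HasSphereCoords.eventually_ne {f : ℂ → OnePoint ℂ} {P Q : ℂ → ℂ} {z : ℂ}
    (h : HasSphereCoords f P Q z) : ∀ᶠ w in 𝓝 z, P w ≠ 0 ∨ Q w ≠ 0 := by
  obtain ⟨hP, hQ, h0, -⟩ := h
  rcases h0 with h0 | h0
  · exact (hP.continuousAt.eventually_ne h0).mono fun _ => Or.inl
  · exact (hQ.continuousAt.eventually_ne h0).mono fun _ => Or.inr

lemma HasSphereCoords.eventually {f : ℂ → OnePoint ℂ} {P Q : ℂ → ℂ} {z : ℂ}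
    (h : HasSphereCoords f P Q z) : ∀ᶠ w in 𝓝 z, HasSphereCoords f P Q w := by
  filter_upwards [h.1.eventually_analyticAt, h.2.1.eventually_analyticAt, h.eventually_ne,
    h.2.2.2.eventually_nhds] with w h1 h2 h3 h4
  exact ⟨h1, h2, h3, h4⟩

/-- Identity theorem: if, sufficiently close to `z`, one sphere-valued holomorphic function is
a fixed Möbius transform of another one, then it is so near `z`. -/
lemma HolomorphicToSphereAt.identity_smul {f g : ℂ → OnePoint ℂ} {z : ℂ}
    (hf : HolomorphicToSphereAt f z) (hg : HolomorphicToSphereAt g z) :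
    ∀ᶠ w in 𝓝 z, ∀ A : GL (Fin 2) ℂ,
      f =ᶠ[𝓝 w] (fun x => A • g x) → f =ᶠ[𝓝 z] fun x => A • g x := by
  obtain ⟨P, Q, h⟩ := hf.exists_coords
  obtain ⟨P₀, Q₀, h'⟩ := hg.exists_coords
  -- The ball is fixed by the coordinates alone, so it serves every A. This matters later, where A
  -- is found only after the nearby point w.
  obtain ⟨r, hr, hball₀⟩ := Metric.eventually_nhds_iff_ball.1 (h.eventually.and h'.eventually)
  filter_upwards [Metric.ball_mem_nhds z hr] with w hw A hfg
  have hball := fun x hx => (hball₀ x hx).imp_right fun h => h.smul A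
  set P' := fun w => A 0 0 * P₀ w + A 0 1 * Q₀ w
  set Q' := fun w => A 1 0 * P₀ w + A 1 1 * Q₀ w
  -- The cross product is an ordinary analytic function that vanishes exactly where the two sphere
  -- points coincide.
  have hD : AnalyticOnNhd ℂ (fun x => P x * Q' x - P' x * Q x) (Metric.ball z r) := fun x hx =>
    ((hball x hx).1.1.mul (hball x hx).2.2.1).sub ((hball x hx).2.1.mul (hball x hx).1.2.1)
  have h0 : (fun x => P x * Q' x - P' x * Q x) =ᶠ[𝓝 w] 0 := by
    filter_upwards [hfg, Metric.isOpen_ball.mem_nhds hw] with x hx hxb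
    obtain ⟨⟨_, _, n1, e1⟩, ⟨_, _, n2, e2⟩⟩ := hball x hxb
    have e2' : A • g x = toSphere (P' x) (Q' x) := e2.self_of_nhds
    rw [e1.self_of_nhds, e2', toSphere_eq_iff n1 n2] at hx
    simp [hx]
  have hz := hD.eqOn_zero_of_preconnected_of_eventuallyEq_zero
    (convex_ball z r).isPreconnected hw h0
  filter_upwards [Metric.ball_mem_nhds z hr] with x hxb
  obtain ⟨⟨_, _, n1, e1⟩, ⟨_, _, n2, e2⟩⟩ := hball x hxb
  have e2' : A • g x = toSphere (P' x) (Q' x) := e2.self_of_nhds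
  rw [e1.self_of_nhds, e2', toSphere_eq_iff n1 n2]
  exact sub_eq_zero.1 (hz hxb)

lemma HolomorphicToSphereAt.identity {f g : ℂ → OnePoint ℂ} {z : ℂ}
    (hf : HolomorphicToSphereAt f z) (hg : HolomorphicToSphereAt g z) :
    ∀ᶠ w in 𝓝 z, f =ᶠ[𝓝 w] g → f =ᶠ[𝓝 z] g := by
  filter_upwards [hf.identity_smul hg] with w hw
  simpa using hw 1

/-! ### Möbius maps and matrices; uniqueness of continuation -/

/-- The Möbius transformation of an invertible matrix. -/
noncomputable def moebiusOf : GL (Fin 2) ℂ →* moebiusGroup :=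
  (MulAction.toPermHom (GL (Fin 2) ℂ) (OnePoint ℂ)).rangeRestrict

lemma moebiusOf_apply (g : GL (Fin 2) ℂ) (x : OnePoint ℂ) :
    (moebiusOf g : Equiv.Perm (OnePoint ℂ)) x = g • x := rfl

lemma moebiusOf_surjective : Function.Surjective moebiusOf :=
  MonoidHom.rangeRestrict_surjective _

/-- Bijections that agree off one point agree there too. -/
lemma moebius_ext {γ γ' : moebiusGroup}
    (h : ∀ z : ℂ, (γ : Equiv.Perm (OnePoint ℂ)) z = (γ' : Equiv.Perm (OnePoint ℂ)) z) :
    γ = γ' := by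
  apply Subtype.ext
  apply Equiv.ext
  intro x
  induction x using OnePoint.rec with
  | coe z => exact h z
  | infty =>
    obtain ⟨y, hy⟩ := (γ' : Equiv.Perm (OnePoint ℂ)).surjective
      ((γ : Equiv.Perm (OnePoint ℂ)) OnePoint.infty)
    induction y using OnePoint.rec with
    | infty => exact hy.symm
    | coe z =>
      rw [← h z] at hy
      exact absurd ((γ : Equiv.Perm (OnePoint ℂ)).injective hy) (OnePoint.coe_ne_infty z)

/-- Fixing ∞, 0 and 1 already makes the matrix scalar. -/
lemma moebiusOf_eq_one_iff (A : GL (Fin 2) ℂ) :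
    moebiusOf A = 1 ↔ A 0 1 = 0 ∧ A 1 0 = 0 ∧ A 0 0 = A 1 1 := by
  have hd := gl_det_ne_zero A
  constructor
  · intro h
    have key : ∀ x : OnePoint ℂ, A • x = x := fun x => by rw [← moebiusOf_apply, h]; rfl
    have h1 := key OnePoint.infty
    rw [OnePoint.smul_infty_eq_self_iff] at h1
    have h2 := key ((0 : ℂ) : OnePoint ℂ)
    have h3 := key ((1 : ℂ) : OnePoint ℂ)
    rw [h1] at hd
    have hd' : A 1 1 ≠ 0 := by rintro h; simp [h] at hd
    simp only [OnePoint.smul_some_eq_ite, h1, zero_add, hd', if_false, mul_zero, mul_one,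
      OnePoint.coe_eq_coe] at h2 h3
    have h2' : A 0 1 = 0 := by simpa [hd'] using h2
    rw [h2', div_eq_iff hd'] at h3
    exact ⟨h2', h1, by simpa using h3⟩
  · rintro ⟨h1, h2, h3⟩
    apply moebius_ext
    intro z
    have hd' : A 1 1 ≠ 0 := by rintro h; simp [h, h3] at hd; simp_all
    rw [moebiusOf_apply]
    simp [OnePoint.smul_some_eq_ite, h1, h2, h3, hd']

/-- Möbius transformations that agree near a finite point are equal. -/
lemma moebius_eq_of_eventually {γ γ' : moebiusGroup} {x₀ : ℂ}
    (h : ∀ᶠ x : ℂ in 𝓝 x₀,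
      (γ : Equiv.Perm (OnePoint ℂ)) x = (γ' : Equiv.Perm (OnePoint ℂ)) x) : γ = γ' := by
  obtain ⟨A, rfl⟩ := moebiusOf_surjective γ
  obtain ⟨B, rfl⟩ := moebiusOf_surjective γ'
  have hE : ∀ᶠ x : ℂ in 𝓝 x₀, (A 0 0 * x + A 0 1) * (B 1 0 * x + B 1 1)
      - (B 0 0 * x + B 0 1) * (A 1 0 * x + A 1 1) = 0 := by
    filter_upwards [h] with x hx
    rw [moebiusOf_apply, moebiusOf_apply, ← toSphere_one, smul_toSphere A (by simp),
      smul_toSphere B (by simp), toSphere_eq_iff (smul_coords_ne_zero A (by simp))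
        (smul_coords_ne_zero B (by simp))] at hx
    simp only [mul_one] at hx
    rw [hx, sub_self]
  have hA : AnalyticOnNhd ℂ (fun x : ℂ => (A 0 0 * x + A 0 1) * (B 1 0 * x + B 1 1)
      - (B 0 0 * x + B 0 1) * (A 1 0 * x + A 1 1)) Set.univ := fun x _ => by fun_prop
  have hall := hA.eqOn_zero_of_preconnected_of_eventuallyEq_zero isPreconnected_univ
    (Set.mem_univ x₀) hE
  apply moebius_ext
  intro x
  rw [moebiusOf_apply, moebiusOf_apply, ← toSphere_one, smul_toSphere A (by simp),
      smul_toSphere B (by simp), toSphere_eq_iff (smul_coords_ne_zero A (by simp))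
        (smul_coords_ne_zero B (by simp))]
  simpa [sub_eq_zero] using hall (Set.mem_univ x)

/-- Uniqueness of analytic continuation along a path. -/
lemma IsContinuationAlong.unique {z₀ z₁ : ℂ} {p : Path z₀ z₁} {F G : unitInterval → ℂ → OnePoint ℂ}
    (hF : IsContinuationAlong p F) (hG : IsContinuationAlong p G)
    (h0 : F 0 =ᶠ[𝓝 z₀] G 0) : F 1 =ᶠ[𝓝 z₁] G 1 := by
  set S : Set unitInterval := {t | F t =ᶠ[𝓝 (p t)] G t} with hS
  -- Membership in S is locally constant, so connectedness of the interval finishes the proof.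
  have key : ∀ t, ∀ᶠ s in 𝓝 t, (s ∈ S ↔ t ∈ S) := by
    intro t
    have hid := p.continuous.continuousAt.eventually ((hF t).1.identity (hG t).1)
    have hfw : ∀ᶠ s in 𝓝 t, t ∈ S → F t =ᶠ[𝓝 (p s)] G t := by
      by_cases ht : t ∈ S
      · filter_upwards [p.continuous.continuousAt.eventually
          (Filter.Eventually.eventually_nhds (show ∀ᶠ w in 𝓝 (p t), F t w = G t w from ht))]
          with s hs _ using hs
      · simp [ht]
    filter_upwards [hid, hfw, (hF t).2, (hG t).2] with s h1 h2 h3 h4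
    exact ⟨fun hs => h1 ((h3.symm.trans hs).trans h4), fun ht => (h3.trans (h2 ht)).trans h4.symm⟩
  have hclopen : IsClopen S := by
    constructor
    · rw [← isOpen_compl_iff, isOpen_iff_mem_nhds]
      intro t ht
      filter_upwards [key t] with s hs hsS
      exact ht (hs.1 hsS)
    · rw [isOpen_iff_mem_nhds]
      intro t ht
      filter_upwards [key t] with s hs using hs.2 ht
  have huniv := hclopen.eq_univ ⟨0, by simpa [hS] using h0⟩
  have : (1 : unitInterval) ∈ S := huniv ▸ Set.mem_univ _
  simpa [hS] using this

/-! ### Conjugacy classes: scalings and translations -/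

/-- The diagonal matrix of `z ↦ lam * z`. -/
noncomputable def scalingGL (lam : ℂ) (h : lam ≠ 0) : GL (Fin 2) ℂ :=
  Matrix.GeneralLinearGroup.mkOfDetNeZero !![lam, 0; 0, 1] (by simp [Matrix.det_fin_two, h])

/-- The matrix of `z ↦ z + b`. -/
noncomputable def translationGL (b : ℂ) : GL (Fin 2) ℂ :=
  Matrix.GeneralLinearGroup.mkOfDetNeZero !![1, b; 0, 1] (by simp [Matrix.det_fin_two])

lemma scalingGL_smul {lam : ℂ} (h : lam ≠ 0) (P Q : ℂ) (hn : P ≠ 0 ∨ Q ≠ 0) :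
    scalingGL lam h • toSphere P Q = toSphere (lam * P) Q := by
  rw [smul_toSphere _ hn]
  simp [scalingGL, Matrix.GeneralLinearGroup.mkOfDetNeZero]

lemma translationGL_smul (b P Q : ℂ) (hn : P ≠ 0 ∨ Q ≠ 0) :
    translationGL b • toSphere P Q = toSphere (P + b * Q) Q := by
  rw [smul_toSphere _ hn]
  simp [translationGL, Matrix.GeneralLinearGroup.mkOfDetNeZero]

lemma scalingGL_smul_coe {lam : ℂ} (h : lam ≠ 0) (z : ℂ) :
    scalingGL lam h • (z : OnePoint ℂ) = ((lam * z : ℂ) : OnePoint ℂ) := by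
  rw [← toSphere_one, scalingGL_smul h _ _ (by simp), toSphere_one]

lemma translationGL_smul_coe (b z : ℂ) :
    translationGL b • (z : OnePoint ℂ) = ((z + b : ℂ) : OnePoint ℂ) := by
  rw [← toSphere_one, translationGL_smul _ _ _ (by simp), mul_one, toSphere_one]

lemma IsConjToScaling.ne_zero {γ : moebiusGroup} {lam : ℂ} (h : IsConjToScaling γ lam) :
    lam ≠ 0 := by
  rintro rfl
  obtain ⟨k, hk⟩ := h
  have := Equiv.injective _ ((hk 0).trans ((by simp : _ = _).trans (hk 1).symm))
  simp at this

lemma isConjToScaling_iff {γ : moebiusGroup} {lam : ℂ} (hl : lam ≠ 0) :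
    IsConjToScaling γ lam ↔ ∃ h : moebiusGroup, h * γ * h⁻¹ = moebiusOf (scalingGL lam hl) := by
  refine exists_congr fun h => ⟨fun H => moebius_ext fun z => ?_, fun H z => ?_⟩
  · rw [H, moebiusOf_apply, scalingGL_smul_coe]
  · rw [H, moebiusOf_apply, scalingGL_smul_coe]

lemma IsConjToScaling.eq_one {lam : ℂ} (h : IsConjToScaling 1 lam) : lam = 1 := by
  obtain ⟨k, hk⟩ := h
  have := hk 1
  simpa using this.symm

/-- The multiplier of a Möbius transformation is determined up to inversion. -/
lemma IsConjToScaling.eq_or_mul_eq_one {γ : moebiusGroup} {lam mu : ℂ}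
    (h : IsConjToScaling γ lam) (h' : IsConjToScaling γ mu) : lam = mu ∨ lam * mu = 1 := by
  have hl := h.ne_zero
  have hm := h'.ne_zero
  obtain ⟨h₁, e₁⟩ := (isConjToScaling_iff hl).1 h
  obtain ⟨h₂, e₂⟩ := (isConjToScaling_iff hm).1 h'
  obtain ⟨K, hK⟩ := moebiusOf_surjective (h₂ * h₁⁻¹)
  have e : moebiusOf (scalingGL mu hm * K) = moebiusOf (K * scalingGL lam hl) := by
    rw [map_mul, map_mul, hK, ← e₁, ← e₂]
    group
  -- Equal Möbius maps come from proportional matrices.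
  have e' : ∃ c : ℂ, ∀ i j, (scalingGL mu hm * K) i j = c * (K * scalingGL lam hl) i j := by
    set B := scalingGL mu hm * K
    set A := K * scalingGL lam hl
    have h1 : moebiusOf (A⁻¹ * B) = 1 := by rw [map_mul, map_inv, e, inv_mul_cancel]
    obtain ⟨z1, z2, z3⟩ := (moebiusOf_eq_one_iff _).1 h1
    refine ⟨(A⁻¹ * B) 1 1, fun i j => ?_⟩
    have hB : B = A * (A⁻¹ * B) := by group
    conv_lhs => rw [hB]
    generalize A⁻¹ * B = C at *
    rw [Matrix.GeneralLinearGroup.coe_mul, Matrix.mul_apply, Fin.sum_univ_two]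
    fin_cases j <;> simp [z1, z2, z3, mul_comm]
  obtain ⟨c, hc⟩ := e'
  have c00 := hc 0 0
  have c01 := hc 0 1
  have c10 := hc 1 0
  have c11 := hc 1 1
  simp only [Matrix.GeneralLinearGroup.coe_mul, Matrix.mul_apply, Fin.sum_univ_two, scalingGL,
    Matrix.GeneralLinearGroup.mkOfDetNeZero] at c00 c01 c10 c11
  simp at c00 c01 c10 c11
  have hd := gl_det_ne_zero K
  -- If K 1 1 = 0, the off-diagonal entries give mu = c and c * lam = 1, so the multiplier is
  -- inverted. Otherwise c = 1 and the multipliers are equal.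
  by_cases h11 : K 1 1 = 0
  · have h01 : K 0 1 ≠ 0 := by rintro h; simp [h, h11] at hd
    have h10 : K 1 0 ≠ 0 := by rintro h; simp [h, h11] at hd
    right
    have hmc : mu = c := c01.resolve_right h01
    have : K 1 0 * 1 = K 1 0 * (c * lam) := by linear_combination c10
    rw [hmc, mul_comm]
    exact (mul_left_cancel₀ h10 this).symm
  · have hc1 : c = 1 := by
      have : K 1 1 * 1 = K 1 1 * c := by linear_combination c11
      exact (mul_left_cancel₀ h11 this).symm
    subst hc1
    by_cases h00 : K 0 0 = 0
    · have h01 : K 0 1 ≠ 0 := by rintro h; simp [h, h00] at hd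
      have h10 : K 1 0 ≠ 0 := by rintro h; simp [h, h00] at hd
      have hm1 : mu = 1 := c01.resolve_right h01
      have hl1 : lam = 1 := (mul_left_cancel₀ h10 (by linear_combination c10)).symm
      left; rw [hm1, hl1]
    · left
      exact (mul_left_cancel₀ h00 (by linear_combination c00)).symm

lemma isConjToScaling_conj (g : moebiusGroup) {lam : ℂ} (hl : lam ≠ 0) :
    IsConjToScaling (g * moebiusOf (scalingGL lam hl) * g⁻¹) lam :=
  (isConjToScaling_iff hl).2 ⟨g⁻¹, by group⟩

/-- Rescaling by b⁻¹ turns the translation by b into the translation by 1. -/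
lemma isParabolicMoebius_conj (g : moebiusGroup) {b : ℂ} (hb : b ≠ 0) :
    IsParabolicMoebius (g * moebiusOf (translationGL b) * g⁻¹) := by
  refine ⟨moebiusOf (scalingGL b⁻¹ (inv_ne_zero hb)) * g⁻¹, fun z => ?_⟩
  have : moebiusOf (scalingGL b⁻¹ (inv_ne_zero hb)) * g⁻¹ * (g * moebiusOf (translationGL b) * g⁻¹)
      * (moebiusOf (scalingGL b⁻¹ (inv_ne_zero hb)) * g⁻¹)⁻¹
      = moebiusOf (scalingGL b⁻¹ (inv_ne_zero hb) * translationGL b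
        * (scalingGL b⁻¹ (inv_ne_zero hb))⁻¹) := by
    simp only [map_mul, map_inv]; group
  rw [this, moebiusOf_apply, mul_smul, mul_smul]
  have hinv : (scalingGL b⁻¹ (inv_ne_zero hb))⁻¹ • (z : OnePoint ℂ)
      = ((b * z : ℂ) : OnePoint ℂ) := by
    rw [inv_smul_eq_iff, scalingGL_smul_coe, inv_mul_cancel_left₀ hb]
  rw [hinv, translationGL_smul_coe, scalingGL_smul_coe, mul_add, inv_mul_cancel_left₀ hb,
    inv_mul_cancel₀ hb]

lemma moebiusOf_translationGL_eq_one_iff (b : ℂ) : moebiusOf (translationGL b) = 1 ↔ b = 0 := by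
  rw [moebiusOf_eq_one_iff]
  simp [translationGL, Matrix.GeneralLinearGroup.mkOfDetNeZero]

/-! ### The Schwarzian and the linear equation u'' + (φ/2) u = 0 -/

/-- Near `z`, the function `u` with derivative `du` solves `u'' + (φ / 2) u = 0`. -/
def IsSolutionAt (φ u du : ℂ → ℂ) (z : ℂ) : Prop :=
  ∀ᶠ w in 𝓝 z, HasDerivAt u (du w) w ∧ HasDerivAt du (-(φ w / 2) * u w) w

lemma IsSolutionAt.eventually {φ u du : ℂ → ℂ} {z : ℂ} (h : IsSolutionAt φ u du z) :
    ∀ᶠ w in 𝓝 z, IsSolutionAt φ u du w := h.eventually_nhds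

lemma IsSolutionAt.analyticAt {φ u du : ℂ → ℂ} {z : ℂ} (h : IsSolutionAt φ u du z) :
    AnalyticAt ℂ u z :=
  Complex.analyticAt_iff_eventually_differentiableAt.2 (h.mono fun _ hw => hw.1.differentiableAt)

lemma eventually_eq_of_hasDerivAt_zero {f : ℂ → ℂ} {z : ℂ}
    (h : ∀ᶠ w in 𝓝 z, HasDerivAt f 0 w) : ∀ᶠ w in 𝓝 z, f w = f z := by
  obtain ⟨r, hr, hball⟩ := Metric.eventually_nhds_iff_ball.1 h
  filter_upwards [Metric.ball_mem_nhds z hr] with w hw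
  exact Metric.isOpen_ball.is_const_of_deriv_eq_zero (convex_ball z r).isPreconnected
    (fun x hx => (hball x hx).differentiableAt.differentiableWithinAt)
    (fun x hx => (hball x hx).deriv) hw (Metric.mem_ball_self hr)

/-- The equation has no first-order term, so the derivative u v'' - u'' v of the Wronskian is zero.
-/
lemma IsSolutionAt.wronskian {φ u du v dv : ℂ → ℂ} {z : ℂ} (hu : IsSolutionAt φ u du z)
    (hv : IsSolutionAt φ v dv z) :
    ∀ᶠ w in 𝓝 z, u w * dv w - du w * v w = u z * dv z - du z * v z := by
  refine eventually_eq_of_hasDerivAt_zero (f := fun w => u w * dv w - du w * v w) ?_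
  filter_upwards [hu, hv] with w h1 h2
  refine ((h1.1.mul h2.2).sub (h1.2.mul h2.1)).congr_deriv ?_
  ring

/-- The quotient of two independent solutions of `u'' + (φ / 2) u = 0` has Schwarzian `φ`. -/
lemma IsSolutionAt.schwarzian_div {φ u du v dv : ℂ → ℂ} {z : ℂ} (hu : IsSolutionAt φ u du z)
    (hv : IsSolutionAt φ v dv z) (hu0 : u z ≠ 0) (hW : u z * dv z - du z * v z ≠ 0) :
    deriv (fun w => v w / u w) z ≠ 0 ∧ schwarzian (fun w => v w / u w) z = φ z := by
  set W := u z * dv z - du z * v z with hWdef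
  have hne : ∀ᶠ w in 𝓝 z, u w ≠ 0 := hu.analyticAt.continuousAt.eventually_ne hu0
  have d1 : deriv (fun w => v w / u w) =ᶠ[𝓝 z] fun w => W / u w ^ 2 := by
    filter_upwards [hu, hv, hne, hu.wronskian hv] with w h1 h2 h3 h4
    refine HasDerivAt.deriv ((h2.1.div h1.1 h3).congr_deriv ?_)
    rw [hWdef, ← h4]
    ring
  have d2 : deriv (deriv (fun w => v w / u w)) =ᶠ[𝓝 z] fun w => -2 * W * du w / u w ^ 3 := by
    filter_upwards [d1.eventuallyEq_nhds, hu, hne] with w h1 h2 h3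
    rw [h1.deriv_eq]
    refine HasDerivAt.deriv ?_
    refine ((hasDerivAt_const w W).div (h2.1.pow 2) (pow_ne_zero 2 h3)).congr_deriv ?_
    simp only [Pi.pow_apply]
    field_simp
    push_cast
    ring
  have d3 : deriv (deriv (deriv (fun w => v w / u w))) z
      = -2 * W * (-(φ z / 2) / u z ^ 2 - 3 * du z ^ 2 / u z ^ 4) := by
    rw [d2.deriv_eq]
    refine HasDerivAt.deriv ?_
    have h2 := hu.self_of_nhds
    refine ((h2.2.const_mul (-2 * W)).div (h2.1.pow 3) (pow_ne_zero 3 hu0)).congr_deriv ?_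
    simp only [Pi.pow_apply]
    field_simp
    push_cast
    ring
  rw [schwarzian, iteratedDeriv_succ, iteratedDeriv_succ, iteratedDeriv_one, d3,
    d2.self_of_nhds, d1.self_of_nhds]
  refine ⟨div_ne_zero hW (pow_ne_zero 2 hu0), ?_⟩
  field_simp
  ring

lemma HasSphereCoords.finitePart_eq {f : ℂ → OnePoint ℂ} {P Q : ℂ → ℂ} {z : ℂ}
    (h : HasSphereCoords f P Q z) (hQ : Q z ≠ 0) :
    finitePart f =ᶠ[𝓝 z] fun w => P w / Q w := by
  filter_upwards [h.2.2.2, h.2.1.continuousAt.eventually_ne hQ] with w h1 h2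
  rw [finitePart, h1, toSphere_of_ne h2]
  rfl

lemma schwarzian_congr {f g : ℂ → ℂ} {z : ℂ} (h : f =ᶠ[𝓝 z] g) :
    schwarzian f z = schwarzian g z := by
  simp only [schwarzian, h.iteratedDeriv_eq, h.deriv_eq]

/-- A quotient of two solutions, as a sphere-valued function. -/
lemma IsSolutionAt.hasSphereCoords {φ u du v dv : ℂ → ℂ} {z : ℂ} (hu : IsSolutionAt φ u du z)
    (hv : IsSolutionAt φ v dv z) (hW : u z * dv z - du z * v z ≠ 0) :
    HasSphereCoords (fun w => toSphere (v w) (u w)) v u z := by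
  refine ⟨hv.analyticAt, hu.analyticAt, ?_, Eventually.of_forall fun _ => rfl⟩
  by_contra! h
  simp [h.1, h.2] at hW

lemma IsSolutionAt.isSchwarzianPrimitiveAt {φ u du v dv : ℂ → ℂ} {z : ℂ}
    (hu : IsSolutionAt φ u du z) (hv : IsSolutionAt φ v dv z)
    (hW : u z * dv z - du z * v z ≠ 0) :
    IsSchwarzianPrimitiveAt φ (fun w => toSphere (v w) (u w)) z := by
  refine ⟨(hu.hasSphereCoords hv hW).holomorphic, ?_⟩
  -- At a zero of u the Wronskian forces u' ≠ 0, so the zero is isolated.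
  have hne : ∀ᶠ w in 𝓝[≠] z, u w ≠ 0 := by
    by_cases h0 : u z = 0
    · refine hu.self_of_nhds.1.eventually_ne ?_
      rintro h
      simp [h0, h] at hW
    · exact (hu.analyticAt.continuousAt.eventually_ne h0).filter_mono nhdsWithin_le_nhds
  have hnear : ∀ᶠ w in 𝓝[≠] z, IsSolutionAt φ u du w ∧ IsSolutionAt φ v dv w ∧
      u w * dv w - du w * v w ≠ 0 := by
    refine Eventually.filter_mono nhdsWithin_le_nhds ?_
    filter_upwards [hu.eventually, hv.eventually, hu.wronskian hv] with w h1 h2 h3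
    exact ⟨h1, h2, h3 ▸ hW⟩
  filter_upwards [hne, hnear] with w h0 ⟨h1, h2, h3⟩
  have hfp := (h1.hasSphereCoords h2 h3).finitePart_eq h0
  obtain ⟨k1, k2⟩ := h1.schwarzian_div h2 h0 h3
  refine ⟨by rw [toSphere_of_ne h0]; exact OnePoint.coe_ne_infty _, ?_, ?_⟩
  · rwa [hfp.deriv_eq]
  · rwa [schwarzian_congr hfp]

/-- A holomorphic function with Schwarzian `φ` is a quotient of two solutions of
`u'' + (φ / 2) u = 0` whose Wronskian does not vanish. -/
lemma exists_solutions_of_schwarzian {φ f : ℂ → ℂ} {z : ℂ} (hf : AnalyticAt ℂ f z)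
    (hd : deriv f z ≠ 0) (hS : ∀ᶠ w in 𝓝 z, schwarzian f w = φ w) :
    ∃ y dy dx : ℂ → ℂ, IsSolutionAt φ y dy z ∧ IsSolutionAt φ (fun w => f w * y w) dx z ∧
      y z ≠ 0 ∧ y z * dx z - dy z * (f z * y z) ≠ 0 := by
  set f1 := deriv f with hf1
  set f2 := deriv f1 with hf2
  set f3 := deriv f2 with hf3
  have a1 : AnalyticAt ℂ f1 z := hf.deriv
  have a2 : AnalyticAt ℂ f2 z := a1.deriv
  set y : ℂ → ℂ := fun w => exp (-(1 / 2) * log (f1 w / f1 z)) with hy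
  have hyne : ∀ w, y w ≠ 0 := fun w => exp_ne_zero _
  have hslit : ∀ᶠ w in 𝓝 z, f1 w / f1 z ∈ slitPlane := by
    have : ContinuousAt (fun w => f1 w / f1 z) z := a1.continuousAt.div_const _
    refine this.eventually (isOpen_slitPlane.mem_nhds ?_)
    simp [div_self hd]
  have hne : ∀ᶠ w in 𝓝 z, f1 w ≠ 0 := a1.continuousAt.eventually_ne hd
  set dy : ℂ → ℂ := fun w => -(1 / 2) * (f2 w / f1 w) * y w with hdy
  have hder : ∀ᶠ w in 𝓝 z, HasDerivAt f (f1 w) w ∧ HasDerivAt f1 (f2 w) w ∧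
      HasDerivAt f2 (f3 w) w := by
    filter_upwards [hf.eventually_analyticAt, a1.eventually_analyticAt,
      a2.eventually_analyticAt] with w h1 h2 h3
    exact ⟨h1.differentiableAt.hasDerivAt, h2.differentiableAt.hasDerivAt,
      h3.differentiableAt.hasDerivAt⟩
  have hy' : ∀ᶠ w in 𝓝 z, HasDerivAt y (dy w) w := by
    filter_upwards [hslit, hne, hder] with w h1 h2 h3
    refine (((h3.2.1.div_const (f1 z)).clog h1).const_mul (-(1 / 2))).cexp.congr_deriv ?_
    simp only [hdy, hy]
    field_simp
  have hdy' : ∀ᶠ w in 𝓝 z, HasDerivAt dy (-(φ w / 2) * y w) w := by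
    filter_upwards [hne, hder, hy', hS] with w h2 h3 h4 h5
    refine (((h3.2.2.div h3.2.1 h2).const_mul (-(1 / 2))).mul h4).congr_deriv ?_
    rw [← h5, schwarzian, iteratedDeriv_succ, iteratedDeriv_succ, iteratedDeriv_one]
    simp only [← hf1, ← hf2, ← hf3, hdy, Pi.div_apply]
    field_simp
    ring
  refine ⟨y, dy, fun w => f1 w * y w + f w * dy w, hy'.and hdy', ?_, hyne z, ?_⟩
  · filter_upwards [hne, hder, hy', hdy'] with w h2 h3 h4 h5
    refine ⟨h3.1.mul h4, ((h3.2.1.mul h4).add (h3.1.mul h5)).congr_deriv ?_⟩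
    simp only [hdy]
    field_simp
    ring
  · have : y z * (f1 z * y z + f z * dy z) - dy z * (f z * y z) = f1 z * y z ^ 2 := by ring
    rw [this]
    exact mul_ne_zero hd (pow_ne_zero 2 (hyne z))

/-- Solutions with non-vanishing Wronskian form a basis. -/
lemma IsSolutionAt.eq_combination {φ u du v dv y dy : ℂ → ℂ} {z : ℂ} (hu : IsSolutionAt φ u du z)
    (hv : IsSolutionAt φ v dv z) (hy : IsSolutionAt φ y dy z)
    (hW : u z * dv z - du z * v z ≠ 0) :
    ∃ α β : ℂ, (∀ᶠ w in 𝓝 z, y w = α * v w + β * u w) ∧ dy z = α * dv z + β * du z := by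
  set W := u z * dv z - du z * v z with hWdef
  -- Cramer's rule: the coefficients are quotients of Wronskians, hence constant.
  refine ⟨(u z * dy z - du z * y z) / W, -(v z * dy z - dv z * y z) / W, ?_, ?_⟩
  · filter_upwards [hu.wronskian hv, hu.wronskian hy, hv.wronskian hy] with w h1 h2 h3
    rw [← h2, ← h3]
    field_simp
    rw [hWdef, ← h1]
    ring
  · field_simp
    rw [hWdef]
    ring

/-- Every sphere-valued solution of `S_f = φ` is a Möbius transform of a quotient of two independent
solutions of `u'' + (φ / 2) u = 0`. -/
lemma IsSchwarzianPrimitiveAt.eq_smul {φ u du v dv : ℂ → ℂ} {f : ℂ → OnePoint ℂ} {z : ℂ}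
    (hf : IsSchwarzianPrimitiveAt φ f z) (hu : IsSolutionAt φ u du z)
    (hv : IsSolutionAt φ v dv z) (hW : u z * dv z - du z * v z ≠ 0) :
    ∃ g : GL (Fin 2) ℂ, f =ᶠ[𝓝 z] fun w => g • toSphere (v w) (u w) := by
  obtain ⟨hol, hp⟩ := hf
  obtain ⟨P, Q, hPQ⟩ := hol.exists_coords
  have hgood : ∀ᶠ w in 𝓝[≠] z, ∀ᶠ x in 𝓝 w, f x ≠ OnePoint.infty ∧
      deriv (finitePart f) x ≠ 0 ∧ schwarzian (finitePart f) x = φ x := by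
    filter_upwards [eventually_eventually_nhdsWithin.2 hp, self_mem_nhdsWithin] with w h1 h2
    rwa [isOpen_compl_singleton.nhdsWithin_eq h2] at h1
  have hnear : ∀ᶠ w in 𝓝[≠] z, HasSphereCoords f P Q w ∧ IsSolutionAt φ u du w ∧
      IsSolutionAt φ v dv w ∧ u w * dv w - du w * v w ≠ 0 ∧ ∀ A : GL (Fin 2) ℂ,
        f =ᶠ[𝓝 w] (fun x => A • toSphere (v x) (u x)) →
          f =ᶠ[𝓝 z] fun x => A • toSphere (v x) (u x) := by
    refine Eventually.filter_mono nhdsWithin_le_nhds ?_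
    filter_upwards [hPQ.eventually, hu.eventually, hv.eventually, hu.wronskian hv,
      hol.identity_smul (hu.hasSphereCoords hv hW).holomorphic] with w h1 h2 h3 h4 h5
    exact ⟨h1, h2, h3, h4 ▸ hW, h5⟩
  -- At z itself f may have a pole, so g is found at a nearby point w and `hid` carries the identity
  -- back to z.
  obtain ⟨w, hw, hPQw, huw, hvw, hWw, hid⟩ := (hgood.and hnear).exists
  have hQw : Q w ≠ 0 := by
    intro h0
    refine hw.self_of_nhds.1 ?_
    rw [hPQw.2.2.2.self_of_nhds, toSphere, if_pos h0]
  have hfp := hPQw.finitePart_eq hQw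
  have han : AnalyticAt ℂ (finitePart f) w := (hPQw.1.div hPQw.2.1 hQw).congr hfp.symm
  obtain ⟨y, dy, dx, hy, hx, hy0, hyx⟩ := exists_solutions_of_schwarzian han
    hw.self_of_nhds.2.1 (hw.mono fun _ h => h.2.2)
  obtain ⟨α, β, e1, e2⟩ := huw.eq_combination hvw hy hWw
  obtain ⟨α', β', e3, e4⟩ := huw.eq_combination hvw hx hWw
  -- The Wronskian of y and f y is this determinant times that of u and v.
  have hdet : (!![α', β'; α, β]).det ≠ 0 := by
    intro h
    rw [Matrix.det_fin_two_of] at h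
    apply hyx
    rw [e3.self_of_nhds, e1.self_of_nhds, e2, e4]
    linear_combination (u w * dv w - du w * v w) * h
  refine ⟨Matrix.GeneralLinearGroup.mkOfDetNeZero _ hdet, hid _ ?_⟩
  have hcoords := huw.hasSphereCoords hvw hWw
  filter_upwards [e1, e3, hcoords.eventually_ne, hw, hy.analyticAt.continuousAt.eventually_ne hy0]
    with x h1 h3 hn hfx hyx
  rw [smul_toSphere _ hn]
  simp only [Matrix.GeneralLinearGroup.mkOfDetNeZero, Matrix.GeneralLinearGroup.val_mk']
  simp only [Matrix.of_apply, Matrix.cons_val', Matrix.cons_val_zero, Matrix.cons_val_one,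
    Matrix.cons_val_fin_one]
  rw [← h1, ← h3, toSphere_of_ne hyx, mul_div_cancel_right₀ _ hyx]
  have := hfx.1
  rw [finitePart]
  induction hv : f x using OnePoint.rec with
  | infty => exact absurd hv this
  | coe c => rfl

/-! ### Branches of the logarithm, developing pairs and holonomy -/

/-- The branch of the logarithm near `exp ζ₀` with value `ζ₀` at `exp ζ₀`. -/
noncomputable def logBranch (ζ₀ z : ℂ) : ℂ := ζ₀ + log (z / exp ζ₀)

lemma exp_logBranch (ζ₀ : ℂ) {z : ℂ} (hz : z ≠ 0) : exp (logBranch ζ₀ z) = z := by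
  rw [logBranch, exp_add, exp_log (div_ne_zero hz (exp_ne_zero _)),
    mul_div_cancel₀ _ (exp_ne_zero _)]

lemma logBranch_exp (ζ₀ : ℂ) : logBranch ζ₀ (exp ζ₀) = ζ₀ := by
  simp [logBranch]

lemma eventually_div_mem_slitPlane {z₀ : ℂ} (hz₀ : z₀ ≠ 0) :
    ∀ᶠ z in 𝓝 z₀, z / z₀ ∈ slitPlane := by
  have : ContinuousAt (fun z => z / z₀) z₀ := by fun_prop
  refine this.eventually (isOpen_slitPlane.mem_nhds ?_)
  simp [div_self hz₀]

lemma hasDerivAt_logBranch (ζ₀ : ℂ) :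
    ∀ᶠ z in 𝓝 (exp ζ₀), HasDerivAt (logBranch ζ₀) z⁻¹ z := by
  filter_upwards [eventually_div_mem_slitPlane (exp_ne_zero ζ₀)] with z hz
  have hz0 : z ≠ 0 := by rintro rfl; simp at hz
  refine ((((hasDerivAt_id z).div_const (exp ζ₀)).clog hz).const_add ζ₀).congr_deriv ?_
  have := exp_ne_zero ζ₀
  simp only [id]
  field_simp

lemma eventually_norm_log_div_lt {z₀ : ℂ} (hz₀ : z₀ ≠ 0) {ε : ℝ} (hε : 0 < ε) :
    ∀ᶠ z in 𝓝 z₀, ‖log (z / z₀)‖ < ε := by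
  have h1 : ContinuousAt (fun z => log (z / z₀)) z₀ := by
    refine ContinuousAt.clog (by fun_prop) (by simp [div_self hz₀])
  have h2 := h1.norm
  refine h2.eventually_lt continuousAt_const ?_
  simpa [div_self hz₀] using hε

/-- Distinct logarithms of one number are at least 2π > 6 apart. -/
lemma eq_of_exp_eq_of_norm_sub_lt {x y : ℂ} (h : exp x = exp y) (hd : ‖x - y‖ < 6) : x = y := by
  obtain ⟨n, hn⟩ := exp_eq_exp_iff_exists_int.1 h
  have hn0 : n = 0 := by
    by_contra hne
    have h1 : (1 : ℝ) ≤ |(n : ℝ)| := by exact_mod_cast Int.one_le_abs hne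
    have h2 : ‖x - y‖ = |(n : ℝ)| * (2 * Real.pi) := by
      rw [hn, add_sub_cancel_left]
      simp [abs_of_pos Real.pi_pos]
    have := Real.pi_gt_three
    nlinarith
  simpa [hn0] using hn

lemma logBranch_add_int (ζ₀ z : ℂ) (n : ℤ) :
    logBranch (ζ₀ + n * (2 * Real.pi * I)) z = logBranch ζ₀ z + n * (2 * Real.pi * I) := by
  rw [logBranch, logBranch, exp_add, exp_int_mul_two_pi_mul_I, mul_one]
  ring

/-- Along a path, nearby branches of the logarithm agree. -/
lemma eventually_logBranch_eq {q : unitInterval → ℂ} (hq : Continuous q) (t : unitInterval) :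
    ∀ᶠ s in 𝓝 t, ∀ᶠ z in 𝓝 (exp (q s)), logBranch (q s) z = logBranch (q t) z := by
  have h1 : ∀ᶠ s in 𝓝 t, ‖q s - q t‖ < 1 := by
    have : ContinuousAt (fun s => ‖q s - q t‖) t := by fun_prop
    exact this.eventually_lt continuousAt_const (by simp)
  have h2 : ∀ᶠ s in 𝓝 t, ∀ᶠ z in 𝓝 (exp (q s)), ‖log (z / exp (q t))‖ < 1 := by
    have : ContinuousAt (fun s => exp (q s)) t := by fun_prop
    exact this.eventually (eventually_norm_log_div_lt (exp_ne_zero _) one_pos).eventually_nhds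
  filter_upwards [h1, h2] with s hs1 hs2
  filter_upwards [hs2, eventually_norm_log_div_lt (exp_ne_zero (q s)) one_pos,
    isOpen_ne.mem_nhds (exp_ne_zero (q s))] with z hz1 hz2 hz0
  refine eq_of_exp_eq_of_norm_sub_lt ?_ ?_
  · rw [exp_logBranch _ hz0, exp_logBranch _ hz0]
  · have e : logBranch (q s) z - logBranch (q t) z
        = (q s - q t) + log (z / exp (q s)) - log (z / exp (q t)) := by
      simp only [logBranch]; ring
    rw [e]
    have n1 := norm_sub_le ((q s - q t) + log (z / exp (q s))) (log (z / exp (q t)))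
    have n2 := norm_add_le (q s - q t) (log (z / exp (q s)))
    linarith

/-- A pair of independent solutions of `v'' = (1 / 4 - z² φ(z) / 2) v`, `z = exp ζ`, whose quotient
`v₂ / v₁` transforms by `M` under `ζ ↦ ζ + 2 π i`. -/
structure IsDevelopingPair (φ : ℂ → ℂ) (R : ℝ) (v₁ dv₁ v₂ dv₂ : ℂ → ℂ) (M : GL (Fin 2) ℂ) :
    Prop where
  deriv₁ : ∀ ζ, exp ζ ∈ puncturedDisk R → HasDerivAt v₁ (dv₁ ζ) ζ ∧
    HasDerivAt dv₁ ((1 / 4 - exp ζ ^ 2 * φ (exp ζ) / 2) * v₁ ζ) ζ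
  deriv₂ : ∀ ζ, exp ζ ∈ puncturedDisk R → HasDerivAt v₂ (dv₂ ζ) ζ ∧
    HasDerivAt dv₂ ((1 / 4 - exp ζ ^ 2 * φ (exp ζ) / 2) * v₂ ζ) ζ
  wronskian : ∀ ζ, exp ζ ∈ puncturedDisk R → v₁ ζ * dv₂ ζ - dv₁ ζ * v₂ ζ ≠ 0
  monodromy : ∀ ζ, exp ζ ∈ puncturedDisk R →
    toSphere (v₂ (ζ + 2 * Real.pi * I)) (v₁ (ζ + 2 * Real.pi * I))
      = M • toSphere (v₂ ζ) (v₁ ζ)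

lemma isOpen_puncturedDisk (R : ℝ) : IsOpen (puncturedDisk R) :=
  (isOpen_lt continuous_const continuous_norm).inter (isOpen_lt continuous_norm continuous_const)

/-- Passing from `v'' = (1 / 4 - z² φ(z) / 2) v` in the coordinate `ζ = log z` to
`u'' + (φ / 2) u = 0` in the coordinate `z`. -/
lemma isSolutionAt_logBranch {φ : ℂ → ℂ} {R : ℝ} {v dv : ℂ → ℂ}
    (h : ∀ ζ, exp ζ ∈ puncturedDisk R → HasDerivAt v (dv ζ) ζ ∧
      HasDerivAt dv ((1 / 4 - exp ζ ^ 2 * φ (exp ζ) / 2) * v ζ) ζ)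
    {ζ₀ : ℂ} (hζ₀ : exp ζ₀ ∈ puncturedDisk R) :
    IsSolutionAt φ (fun z => exp (logBranch ζ₀ z / 2) * v (logBranch ζ₀ z))
      (fun z => exp (logBranch ζ₀ z / 2) * (v (logBranch ζ₀ z) / 2 + dv (logBranch ζ₀ z)) / z)
      (exp ζ₀) := by
  filter_upwards [hasDerivAt_logBranch ζ₀, (isOpen_puncturedDisk R).mem_nhds hζ₀] with z hl hz
  have hz0 : z ≠ 0 := norm_pos_iff.1 hz.1
  have hexp := exp_logBranch ζ₀ hz0
  obtain ⟨h1, h2⟩ := h (logBranch ζ₀ z) (by rwa [hexp])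
  have e1 : HasDerivAt (fun z => exp (logBranch ζ₀ z / 2)) _ z := (hl.div_const 2).cexp
  have e2 : HasDerivAt (fun z => v (logBranch ζ₀ z)) _ z := HasDerivAt.comp z h1 hl
  have e3 : HasDerivAt (fun z => dv (logBranch ζ₀ z)) _ z := HasDerivAt.comp z h2 hl
  constructor
  · refine (e1.mul e2).congr_deriv ?_
    field_simp
  · refine ((e1.mul ((e2.div_const 2).add e3)).div (hasDerivAt_id z) hz0).congr_deriv ?_
    rw [hexp]
    simp only [Pi.add_apply, Pi.mul_apply, id]
    field_simp
    ring

namespace IsDevelopingPair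

variable {φ : ℂ → ℂ} {R : ℝ} {v₁ dv₁ v₂ dv₂ : ℂ → ℂ} {M : GL (Fin 2) ℂ}

/-- The two local solutions carry the same factor exp (ζ/2), which cancels in the quotient. -/
lemma exists_solutions (h : IsDevelopingPair φ R v₁ dv₁ v₂ dv₂ M) {ζ₀ : ℂ}
    (hζ₀ : exp ζ₀ ∈ puncturedDisk R) :
    ∃ u du w dw : ℂ → ℂ, IsSolutionAt φ u du (exp ζ₀) ∧ IsSolutionAt φ w dw (exp ζ₀) ∧
      u (exp ζ₀) * dw (exp ζ₀) - du (exp ζ₀) * w (exp ζ₀) ≠ 0 ∧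
      (fun z => toSphere (v₂ (logBranch ζ₀ z)) (v₁ (logBranch ζ₀ z)))
        = fun z => toSphere (w z) (u z) := by
  refine ⟨_, _, _, _, isSolutionAt_logBranch h.deriv₁ hζ₀, isSolutionAt_logBranch h.deriv₂ hζ₀,
    ?_, ?_⟩
  · simp only [logBranch_exp]
    have e : exp (ζ₀ / 2) * v₁ ζ₀ * (exp (ζ₀ / 2) * (v₂ ζ₀ / 2 + dv₂ ζ₀) / exp ζ₀)
        - exp (ζ₀ / 2) * (v₁ ζ₀ / 2 + dv₁ ζ₀) / exp ζ₀ * (exp (ζ₀ / 2) * v₂ ζ₀)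
        = exp (ζ₀ / 2) ^ 2 / exp ζ₀ * (v₁ ζ₀ * dv₂ ζ₀ - dv₁ ζ₀ * v₂ ζ₀) := by ring
    rw [e]
    exact mul_ne_zero (div_ne_zero (pow_ne_zero _ (exp_ne_zero _)) (exp_ne_zero _))
      (h.wronskian ζ₀ hζ₀)
  · funext z
    have := exp_ne_zero (logBranch ζ₀ z / 2)
    simp only [toSphere, mul_eq_zero, this, false_or, mul_div_mul_left _ _ this]

lemma isSchwarzianPrimitiveAt (h : IsDevelopingPair φ R v₁ dv₁ v₂ dv₂ M) {ζ₀ : ℂ}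
    (hζ₀ : exp ζ₀ ∈ puncturedDisk R) :
    IsSchwarzianPrimitiveAt φ
      (fun z => toSphere (v₂ (logBranch ζ₀ z)) (v₁ (logBranch ζ₀ z))) (exp ζ₀) := by
  obtain ⟨u, du, w, dw, h1, h2, h3, h4⟩ := h.exists_solutions hζ₀
  rw [h4]
  exact h1.isSchwarzianPrimitiveAt h2 h3

lemma eq_smul (h : IsDevelopingPair φ R v₁ dv₁ v₂ dv₂ M) {ζ₀ : ℂ}
    (hζ₀ : exp ζ₀ ∈ puncturedDisk R) {f : ℂ → OnePoint ℂ}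
    (hf : IsSchwarzianPrimitiveAt φ f (exp ζ₀)) :
    ∃ g : GL (Fin 2) ℂ, f =ᶠ[𝓝 (exp ζ₀)]
      fun z => g • toSphere (v₂ (logBranch ζ₀ z)) (v₁ (logBranch ζ₀ z)) := by
  obtain ⟨u, du, w, dw, h1, h2, h3, h4⟩ := h.exists_solutions hζ₀
  obtain ⟨g, hg⟩ := hf.eq_smul h1 h2 h3
  refine ⟨g, hg.trans (Eventually.of_forall fun z => ?_)⟩
  exact congrArg (g • ·) (congrFun h4 z).symm

/-- Since v₂/v₁ is single-valued in ζ, continuing along p only means following the branch of the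
logarithm prescribed by the lift q. -/
lemma isContinuationAlong (h : IsDevelopingPair φ R v₁ dv₁ v₂ dv₂ M) (g : GL (Fin 2) ℂ)
    {z₀ z₁ : ℂ} (p : Path z₀ z₁) (hp : ∀ t, p t ∈ puncturedDisk R) {q : unitInterval → ℂ}
    (hq : Continuous q) (hqp : ∀ t, exp (q t) = p t) :
    IsContinuationAlong p
      fun t z => g • toSphere (v₂ (logBranch (q t) z)) (v₁ (logBranch (q t) z)) := by
  intro t
  constructor
  · rw [← hqp]
    exact (h.isSchwarzianPrimitiveAt (by rw [hqp]; exact hp t)).1.smul g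
  · filter_upwards [eventually_logBranch_eq hq t] with s hs
    rw [hqp] at hs
    filter_upwards [hs] with z hz
    rw [hz]

lemma monodromy_zpow (h : IsDevelopingPair φ R v₁ dv₁ v₂ dv₂ M) (n : ℤ) :
    ∀ ζ, exp ζ ∈ puncturedDisk R →
      toSphere (v₂ (ζ + n * (2 * Real.pi * I))) (v₁ (ζ + n * (2 * Real.pi * I)))
        = M ^ n • toSphere (v₂ ζ) (v₁ ζ) := by
  induction n using Int.induction_on with
  | zero => intro ζ _; simp
  | succ i ih =>
    intro ζ hζ
    have e : ζ + ((i + 1 : ℤ) : ℂ) * (2 * Real.pi * I)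
        = (ζ + ((i : ℤ) : ℂ) * (2 * Real.pi * I)) + 2 * Real.pi * I := by push_cast; ring
    rw [e, h.monodromy _ (by rwa [exp_add, exp_int_mul_two_pi_mul_I, mul_one]), ih ζ hζ, ← mul_smul,
      ← zpow_one_add, add_comm]
  | pred i ih =>
    intro ζ hζ
    have e : ζ + ((-i : ℤ) : ℂ) * (2 * Real.pi * I)
        = (ζ + ((-i - 1 : ℤ) : ℂ) * (2 * Real.pi * I)) + 2 * Real.pi * I := by push_cast; ring
    have h1 := ih ζ hζ
    rw [e, h.monodromy _ (by rwa [exp_add, exp_int_mul_two_pi_mul_I, mul_one])] at h1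
    rw [show M ^ (-(i : ℤ) - 1) = M⁻¹ * M ^ (-(i : ℤ)) by rw [← zpow_neg_one, ← zpow_add]; ring_nf,
      mul_smul, ← h1, inv_smul_smul]

/-- The holonomy along a loop that lifts through `exp` to a path with increment `2 π i n`. -/
lemma isHolonomyAlong (h : IsDevelopingPair φ R v₁ dv₁ v₂ dv₂ M) {g : GL (Fin 2) ℂ} {ζ₀ : ℂ}
    {f₀ : ℂ → OnePoint ℂ}
    (hf₀ : f₀ =ᶠ[𝓝 (exp ζ₀)] fun z => g • toSphere (v₂ (logBranch ζ₀ z)) (v₁ (logBranch ζ₀ z)))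
    (p : Path (exp ζ₀) (exp ζ₀)) (hp : ∀ t, p t ∈ puncturedDisk R) {q : unitInterval → ℂ}
    (hq : Continuous q) (hqp : ∀ t, exp (q t) = p t) (hq0 : q 0 = ζ₀) {n : ℤ}
    (hq1 : q 1 = ζ₀ + n * (2 * Real.pi * I)) :
    IsHolonomyAlong f₀ p ((moebiusOf g * moebiusOf M * (moebiusOf g)⁻¹) ^ n) := by
  refine ⟨_, h.isContinuationAlong g p hp hq hqp, ?_, ?_⟩
  · simpa only [hq0] using hf₀.symm
  · have hU : exp ζ₀ ∈ puncturedDisk R := by rw [← hq0, hqp]; exact hp 0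
    filter_upwards [hf₀, (isOpen_puncturedDisk R).mem_nhds hU] with z hz hzU
    have hz0 : z ≠ 0 := norm_pos_iff.1 hzU.1
    -- The final germ is g Mⁿ (v₂/v₁), which equals (g M g⁻¹)ⁿ applied to f₀ = g (v₂/v₁).
    rw [hz, hq1, logBranch_add_int, h.monodromy_zpow n _ (by rwa [exp_logBranch _ hz0]),
      ← map_inv, ← map_mul, ← map_mul, ← map_zpow, moebiusOf_apply, conj_zpow, mul_smul, mul_smul,
      inv_smul_smul]

end IsDevelopingPair

lemma exists_exp_lift {z₀ z₁ : ℂ} (p : Path z₀ z₁) (hp : ∀ t, p t ≠ 0) {ζ₀ : ℂ}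
    (hζ₀ : exp ζ₀ = z₀) :
    ∃ q : unitInterval → ℂ, Continuous q ∧ (∀ t, exp (q t) = p t) ∧ q 0 = ζ₀ := by
  let γ : C(unitInterval, {z : ℂ // z ≠ 0}) :=
    ⟨fun t => ⟨p t, hp t⟩, by fun_prop⟩
  have h0 : γ 0 = ⟨exp ζ₀, exp_ne_zero ζ₀⟩ := Subtype.ext (by simp [γ, hζ₀])
  obtain ⟨Γ, h1, h2⟩ := Complex.isCoveringMap_exp.exists_path_lifts γ ζ₀ h0
  refine ⟨Γ, Γ.continuous, fun t => ?_, h2⟩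
  exact congrArg Subtype.val (congrFun h1 t)

/-- A holonomy is determined by the loop. -/
lemma IsHolonomyAlong.unique {φ : ℂ → ℂ} {f₀ : ℂ → OnePoint ℂ} {z₀ : ℂ}
    (hf₀ : IsSchwarzianPrimitiveAt φ f₀ z₀) {p : Path z₀ z₀} {γ γ' : moebiusGroup}
    (h : IsHolonomyAlong f₀ p γ) (h' : IsHolonomyAlong f₀ p γ') : γ = γ' := by
  obtain ⟨F, hF, hF0, hF1⟩ := h
  obtain ⟨G, hG, hG0, hG1⟩ := h'
  have hFG := hF1.symm.trans ((hF.unique hG (hF0.trans hG0.symm)).trans hG1)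
  obtain ⟨P, Q, hPQ⟩ := hf₀.1.exists_coords
  obtain ⟨w, hw, hPQw, hFGw⟩ := (hf₀.2.and ((hPQ.eventually.and hFG.eventually_nhds).filter_mono
    nhdsWithin_le_nhds)).exists
  have hQw : Q w ≠ 0 := by
    intro h0
    refine hw.1 ?_
    rw [hPQw.2.2.2.self_of_nhds, toSphere, if_pos h0]
  have hfp := hPQw.finitePart_eq hQw
  have han : AnalyticAt ℂ (finitePart f₀) w := (hPQw.1.div hPQw.2.1 hQw).congr hfp.symm
  -- As f₀' ≠ 0 at w, the values of f₀ fill a neighbourhood, on which the two Möbius maps agree.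
  have hmap := han.hasStrictDerivAt.map_nhds_eq hw.2.1
  refine moebius_eq_of_eventually (x₀ := finitePart f₀ w) ?_
  rw [← hmap, eventually_map]
  filter_upwards [hFGw, hPQw.2.2.2, hPQw.2.1.continuousAt.eventually_ne hQw] with x h1 h2 h3
  have e : ((finitePart f₀ x : ℂ) : OnePoint ℂ) = f₀ x := by
    rw [finitePart, h2, toSphere_of_ne h3]
    rfl
  rw [e]
  exact h1

/-- The holonomy of a developing pair: existence, uniqueness and cyclicity. -/
theorem IsDevelopingPair.holonomy {φ : ℂ → ℂ} {R : ℝ} {v₁ dv₁ v₂ dv₂ : ℂ → ℂ} {M : GL (Fin 2) ℂ}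
    (h : IsDevelopingPair φ R v₁ dv₁ v₂ dv₂ M) {z₀ : ℂ} (hz₀ : z₀ ∈ puncturedDisk R)
    {f₀ : ℂ → OnePoint ℂ} (hf₀ : IsSchwarzianPrimitiveAt φ f₀ z₀) :
    (∀ p : Path z₀ z₀, (∀ t, p t ∈ puncturedDisk R) → ∃! γ : moebiusGroup, IsHolonomyAlong f₀ p γ) ∧
    ∃ g : moebiusGroup, IsHolonomyAlong f₀ (circleLoop z₀) (g * moebiusOf M * g⁻¹) ∧
      holonomySet (puncturedDisk R) z₀ f₀
        = (Subgroup.zpowers (g * moebiusOf M * g⁻¹) : Set moebiusGroup) := by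
  have hz0 : z₀ ≠ 0 := norm_pos_iff.1 hz₀.1
  obtain ⟨ζ₀, rfl⟩ : ∃ ζ₀, exp ζ₀ = z₀ := ⟨log z₀, exp_log hz0⟩
  obtain ⟨g, hg⟩ := h.eq_smul hz₀ hf₀
  have hhol : ∀ p : Path (exp ζ₀) (exp ζ₀), (∀ t, p t ∈ puncturedDisk R) → ∃ n : ℤ,
      IsHolonomyAlong f₀ p ((moebiusOf g * moebiusOf M * (moebiusOf g)⁻¹) ^ n) := by
    intro p hp
    obtain ⟨q, hq, hqp, hq0⟩ := exists_exp_lift p (fun t => norm_pos_iff.1 (hp t).1) rfl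
    have : exp (q 1) = exp ζ₀ := by rw [hqp]; simp
    obtain ⟨n, hn⟩ := exp_eq_exp_iff_exists_int.1 this
    exact ⟨n, h.isHolonomyAlong hg p hp hq hqp hq0 hn⟩
  -- The circle run n times keeps constant modulus, so it stays in U. It gives `circleLoop` for n =
  -- 1 and realises every power of the generator.
  have hloop : ∀ n : ℤ, ∀ p : Path (exp ζ₀) (exp ζ₀),
      (∀ t, p t = exp (ζ₀ + ((t : ℝ) : ℂ) * (n * (2 * Real.pi * I)))) →
      (∀ t, p t ∈ puncturedDisk R) ∧
        IsHolonomyAlong f₀ p ((moebiusOf g * moebiusOf M * (moebiusOf g)⁻¹) ^ n) := by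
    intro n p hp
    have hU : ∀ t, p t ∈ puncturedDisk R := by
      intro t
      have : ‖p t‖ = ‖exp ζ₀‖ := by
        rw [hp, norm_exp, norm_exp]
        congr 1
        simp [mul_comm]
      simpa only [puncturedDisk, Set.mem_ofPred_eq, this] using hz₀
    refine ⟨hU, h.isHolonomyAlong hg p hU
      (q := fun t => ζ₀ + ((t : ℝ) : ℂ) * (n * (2 * Real.pi * I)))
      (by fun_prop) (fun t => (hp t).symm) (by simp) (by simp)⟩
  refine ⟨fun p hp => ?_, moebiusOf g, ?_, ?_⟩
  · obtain ⟨n, hn⟩ := hhol p hp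
    exact ⟨_, hn, fun γ hγ => hγ.unique hf₀ hn⟩
  · have := (hloop 1 (circleLoop (exp ζ₀)) fun t => ?_).2
    · simpa using this
    · rw [exp_add]
      change exp ζ₀ * exp _ = _
      congr 2
      push_cast
      ring
  · ext γ
    rw [SetLike.mem_coe, Subgroup.mem_zpowers_iff]
    constructor
    · rintro ⟨p, hp, hγ⟩
      obtain ⟨n, hn⟩ := hhol p hp
      exact ⟨n, hn.unique hf₀ hγ⟩
    · rintro ⟨n, rfl⟩
      let p : Path (exp ζ₀) (exp ζ₀) :=
        { toFun := fun t => exp (ζ₀ + ((t : ℝ) : ℂ) * (n * (2 * Real.pi * I)))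
          continuous_toFun := by fun_prop
          source' := by simp
          target' := by simp [exp_add, exp_int_mul_two_pi_mul_I] }
      exact ⟨p, hloop n p fun _ => rfl⟩

/-! ### Power series on a disk and convergence of Frobenius recursions -/

/-- The power series `∑ c n z ^ n` converges on the disk of radius `R`. -/
def IsPowerBounded (c : ℕ → ℂ) (R : ℝ) : Prop :=
  ∀ ρ : ℝ, 0 ≤ ρ → ρ < R → ∃ C, ∀ n, ‖c n‖ * ρ ^ n ≤ C

/-- The sum of a power series. -/
noncomputable def powerSum (c : ℕ → ℂ) (z : ℂ) : ℂ := ∑' n, c n * z ^ n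

namespace IsPowerBounded

variable {b c : ℕ → ℂ} {R : ℝ}

/-- Boundedness at an intermediate radius r leaves the geometric factor (ρ/r)ⁿ, which absorbs any
power of n. -/
lemma summable_nat_mul (hc : IsPowerBounded c R) (m : ℕ) {ρ : ℝ} (h0 : 0 ≤ ρ) (h : ρ < R) :
    Summable fun n : ℕ => (n : ℝ) ^ m * (‖c n‖ * ρ ^ n) := by
  obtain ⟨r, hr1, hr2⟩ := exists_between h
  have hr : 0 < r := h0.trans_lt hr1
  obtain ⟨C, hC⟩ := hc r hr.le hr2
  have hs : Summable fun n : ℕ => ((n : ℝ) ^ m * (ρ / r) ^ n) * C := by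
    refine Summable.mul_right _ (summable_pow_mul_geometric_of_norm_lt_one m ?_)
    rw [Real.norm_eq_abs, abs_of_nonneg (by positivity), div_lt_one hr]
    exact hr1
  refine Summable.of_nonneg_of_le (fun n => by positivity) (fun n => ?_) hs
  have e : ‖c n‖ * ρ ^ n = (ρ / r) ^ n * (‖c n‖ * r ^ n) := by
    rw [div_pow]; field_simp
  rw [e, mul_assoc]
  have := hC n
  gcongr

lemma summable_norm (hc : IsPowerBounded c R) {ρ : ℝ} (h0 : 0 ≤ ρ) (h : ρ < R) :
    Summable fun n : ℕ => ‖c n‖ * ρ ^ n := by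
  simpa using hc.summable_nat_mul 0 h0 h

lemma of_summable (h : ∀ ρ : ℝ, 0 ≤ ρ → ρ < R → Summable fun n : ℕ => ‖c n‖ * ρ ^ n) :
    IsPowerBounded c R := by
  intro ρ h0 hρ
  refine ⟨_, fun n => (h ρ h0 hρ).le_tsum n fun j _ => by positivity⟩

lemma summable_norm_mul (hc : IsPowerBounded c R) {z : ℂ} (hz : ‖z‖ < R) :
    Summable fun n : ℕ => ‖c n * z ^ n‖ := by
  simpa [norm_mul, norm_pow] using hc.summable_norm (norm_nonneg z) hz

lemma summable (hc : IsPowerBounded c R) {z : ℂ} (hz : ‖z‖ < R) :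
    Summable fun n : ℕ => c n * z ^ n := (hc.summable_norm_mul hz).of_norm

lemma nat_mul (hc : IsPowerBounded c R) : IsPowerBounded (fun n => n * c n) R := by
  refine of_summable fun ρ h0 h => ?_
  simpa [mul_assoc] using hc.summable_nat_mul 1 h0 h

lemma const_mul (hc : IsPowerBounded c R) (a : ℂ) : IsPowerBounded (fun n => a * c n) R := by
  refine of_summable fun ρ h0 h => ?_
  simpa [mul_assoc] using (hc.summable_norm h0 h).mul_left ‖a‖

lemma add (hb : IsPowerBounded b R) (hc : IsPowerBounded c R) :
    IsPowerBounded (fun n => b n + c n) R := by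
  intro ρ h0 h
  obtain ⟨B, hB⟩ := hb ρ h0 h
  obtain ⟨C, hC⟩ := hc ρ h0 h
  refine ⟨B + C, fun n => ?_⟩
  calc ‖b n + c n‖ * ρ ^ n ≤ (‖b n‖ + ‖c n‖) * ρ ^ n := by gcongr; exact norm_add_le _ _
    _ = ‖b n‖ * ρ ^ n + ‖c n‖ * ρ ^ n := by ring
    _ ≤ B + C := add_le_add (hB n) (hC n)

lemma add_mul (hc : IsPowerBounded c R) (s : ℂ) : IsPowerBounded (fun n => (n + s) * c n) R := by
  simpa [_root_.add_mul] using hc.nat_mul.add (hc.const_mul s)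

lemma powerSum_const_mul (a z : ℂ) : powerSum (fun n => a * c n) z = a * powerSum c z := by
  simp only [powerSum, mul_assoc, tsum_mul_left]

lemma powerSum_add (hb : IsPowerBounded b R) (hc : IsPowerBounded c R) {z : ℂ} (hz : ‖z‖ < R) :
    powerSum (fun n => b n + c n) z = powerSum b z + powerSum c z := by
  simp only [powerSum, _root_.add_mul]
  exact (hb.summable hz).tsum_add (hc.summable hz)

/-- The Cauchy product with a series without constant term. -/
lemma powerSum_mul (hc : IsPowerBounded c R) (hb : IsPowerBounded b R) (hb0 : b 0 = 0) {z : ℂ}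
    (hz : ‖z‖ < R) :
    powerSum (fun n => ∑ i ∈ Finset.range n, c i * b (n - i)) z = powerSum c z * powerSum b z := by
  rw [powerSum, powerSum, powerSum, tsum_mul_tsum_eq_tsum_sum_range_of_summable_norm
    (hc.summable_norm_mul hz) (hb.summable_norm_mul hz)]
  refine tsum_congr fun n => ?_
  rw [Finset.sum_range_succ, Nat.sub_self, hb0, zero_mul, mul_zero, add_zero, Finset.sum_mul]
  refine Finset.sum_congr rfl fun i hi => ?_
  have : z ^ n = z ^ i * z ^ (n - i) := by
    rw [← pow_add, Nat.add_sub_cancel' (Finset.mem_range.1 hi).le]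
  rw [this]; ring

/-- In the coordinate ζ the operator z d/dz is d/dζ, so differentiation keeps the powers and
multiplies coefficients by n. The domain ‖exp ζ‖ < ρ is a half-plane, hence connected. -/
lemma hasDerivAt_powerSum_exp (hc : IsPowerBounded c R) {ζ : ℂ} (hζ : ‖exp ζ‖ < R) :
    HasDerivAt (fun x => powerSum c (exp x)) (powerSum (fun n => n * c n) (exp ζ)) ζ := by
  obtain ⟨ρ, h1, h2⟩ := exists_between hζ
  have h0 : 0 < ρ := (norm_nonneg _).trans_lt h1
  have hset : {x : ℂ | ‖exp x‖ < ρ} = {x : ℂ | x.re < Real.log ρ} := by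
    ext x
    change ‖exp x‖ < ρ ↔ x.re < Real.log ρ
    rw [norm_exp, Real.lt_log_iff_exp_lt h0]
  have hopen : IsOpen {x : ℂ | ‖exp x‖ < ρ} := isOpen_lt (by fun_prop) continuous_const
  have hconn : IsPreconnected {x : ℂ | ‖exp x‖ < ρ} := by
    rw [hset]
    exact (convex_halfSpace_re_lt _).isPreconnected
  have hder : ∀ (n : ℕ) (y : ℂ), y ∈ {x : ℂ | ‖exp x‖ < ρ} →
      HasDerivAt (fun x => c n * exp x ^ n) (n * c n * exp y ^ n) y := by
    intro n y _
    refine (((hasDerivAt_exp y).pow n).const_mul (c n)).congr_deriv ?_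
    rcases n with _ | n
    · simp
    · simp only [Nat.add_sub_cancel, pow_succ]
      ring
  have hbound : ∀ (n : ℕ) (y : ℂ), y ∈ {x : ℂ | ‖exp x‖ < ρ} →
      ‖n * c n * exp y ^ n‖ ≤ ‖n * c n‖ * ρ ^ n := by
    intro n y hy
    rw [norm_mul _ (exp y ^ n), norm_pow]
    exact mul_le_mul_of_nonneg_left (pow_le_pow_left₀ (norm_nonneg _) (le_of_lt hy) n)
      (norm_nonneg _)
  exact hasDerivAt_tsum_of_isPreconnected (hc.nat_mul.summable_norm h0.le h2) hopen hconn hder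
    hbound (show ζ ∈ _ from h1) (hc.summable hζ) h1

lemma tendsto_powerSum (hR : 0 < R) (hc : IsPowerBounded c R) :
    Tendsto (powerSum c) (𝓝 0) (𝓝 (c 0)) := by
  obtain ⟨ρ, h1, h2⟩ := exists_between hR
  have hcont : ContinuousOn (powerSum c) (Metric.ball 0 ρ) := by
    refine continuousOn_tsum (u := fun n => ‖c n‖ * ρ ^ n) (fun n => by fun_prop)
      (hc.summable_norm h1.le h2) fun n x hx => ?_
    rw [norm_mul, norm_pow]
    have : ‖x‖ < ρ := by simpa using hx
    gcongr
  have := hcont.continuousAt (Metric.ball_mem_nhds 0 h1)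
  have e : powerSum c 0 = c 0 := by
    rw [powerSum, tsum_eq_single 0]
    · simp
    · intro n hn; simp [hn]
  simpa [ContinuousAt, e] using this

/-- Convergence of Frobenius series: solutions of the recursion
`n (n + τ) c n + ∑_{i < n} c i b (n - i) = r n` converge where `b` and `r` do. -/
lemma of_recursion {r : ℕ → ℂ} {τ : ℂ} (hb : IsPowerBounded b R) (hr : IsPowerBounded r R)
    (h : ∀ n : ℕ, n * (n + τ) * c n + ∑ i ∈ Finset.range n, c i * b (n - i) = r n) :
    IsPowerBounded c R := by
  intro ρ h0 hρ
  obtain ⟨C₁, hC₁⟩ := hr ρ h0 hρ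
  have hs := hb.summable_norm h0 hρ
  set K := ∑' n, ‖b n‖ * ρ ^ n with hK
  have hK0 : 0 ≤ K := tsum_nonneg fun n => by positivity
  -- Beyond N the divisor beats the convolution: a bound C below n gives C₁ + C K ≤ (K + 1) C at n.
  -- A resonance can only occur among the finitely many n < N, which C₂ covers.
  obtain ⟨N, hN⟩ : ∃ N : ℕ, ∀ n : ℕ, N ≤ n → K + 1 ≤ ‖(n : ℂ) * (n + τ)‖ := by
    obtain ⟨N, hN⟩ := exists_nat_ge (K + 1 + ‖τ‖)
    refine ⟨N + 1, fun n hn => ?_⟩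
    have hn' : (N : ℝ) + 1 ≤ n := by exact_mod_cast hn
    have h1 : (n : ℝ) - ‖τ‖ ≤ ‖(n : ℂ) + τ‖ := by
      have := norm_sub_norm_le (n : ℂ) (-τ)
      simpa using this
    have hτ := norm_nonneg τ
    rw [norm_mul, norm_natCast]
    nlinarith
  obtain ⟨C₂, hC₂⟩ : ∃ C₂, ∀ n < N, ‖c n‖ * ρ ^ n ≤ C₂ := by
    refine ⟨∑ n ∈ Finset.range N, ‖c n‖ * ρ ^ n, fun n hn => ?_⟩
    exact Finset.single_le_sum (f := fun n => ‖c n‖ * ρ ^ n) (fun i _ => by positivity)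
      (Finset.mem_range.2 hn)
  set C := max (max C₁ C₂) 0 with hC
  have hCC1 : C₁ ≤ C := (le_max_left _ _).trans (le_max_left _ _)
  have hCC2 : C₂ ≤ C := (le_max_right _ _).trans (le_max_left _ _)
  have hCC0 : 0 ≤ C := le_max_right _ _
  refine ⟨C, fun n => ?_⟩
  induction n using Nat.strong_induction_on with
  | _ n ih =>
    rcases lt_or_ge n N with hn | hn
    · exact (hC₂ n hn).trans hCC2
    · have hsum : ∑ i ∈ Finset.range n, ‖c i * b (n - i)‖ * ρ ^ n ≤ C * K := by
        calc ∑ i ∈ Finset.range n, ‖c i * b (n - i)‖ * ρ ^ n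
            ≤ ∑ i ∈ Finset.range n, C * (‖b (n - i)‖ * ρ ^ (n - i)) := by
              refine Finset.sum_le_sum fun i hi => ?_
              have hi' := Finset.mem_range.1 hi
              have e : ρ ^ n = ρ ^ i * ρ ^ (n - i) := by
                rw [← pow_add, Nat.add_sub_cancel' hi'.le]
              rw [norm_mul, e, show ‖c i‖ * ‖b (n - i)‖ * (ρ ^ i * ρ ^ (n - i))
                = (‖c i‖ * ρ ^ i) * (‖b (n - i)‖ * ρ ^ (n - i)) by ring]
              have := ih i hi'
              gcongr
          _ ≤ ∑ i ∈ Finset.range (n + 1), C * (‖b (n - i)‖ * ρ ^ (n - i)) :=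
              Finset.sum_le_sum_of_subset_of_nonneg (Finset.range_mono n.le_succ)
                fun _ _ _ => by positivity
          _ = C * ∑ i ∈ Finset.range (n + 1), ‖b i‖ * ρ ^ i := by
              rw [← Finset.mul_sum]
              congr 1
              exact Finset.sum_range_reflect (fun i => ‖b i‖ * ρ ^ i) (n + 1)
          _ ≤ C * K := by
              gcongr
              exact hs.sum_le_tsum _ fun _ _ => by positivity
      have e : (n : ℂ) * (n + τ) * c n = r n - ∑ i ∈ Finset.range n, c i * b (n - i) := by
        rw [← h n]; ring
      have hle : (K + 1) * (‖c n‖ * ρ ^ n) ≤ (K + 1) * C := by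
        calc (K + 1) * (‖c n‖ * ρ ^ n) ≤ ‖(n : ℂ) * (n + τ)‖ * (‖c n‖ * ρ ^ n) := by
              have := hN n hn
              gcongr
          _ = ‖r n - ∑ i ∈ Finset.range n, c i * b (n - i)‖ * ρ ^ n := by
              rw [← e, norm_mul _ (c n)]; ring
          _ ≤ (‖r n‖ + ∑ i ∈ Finset.range n, ‖c i * b (n - i)‖) * ρ ^ n := by
              gcongr
              exact (norm_sub_le _ _).trans (by gcongr; exact norm_sum_le _ _)
          _ = ‖r n‖ * ρ ^ n + ∑ i ∈ Finset.range n, ‖c i * b (n - i)‖ * ρ ^ n := by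
              rw [_root_.add_mul, Finset.sum_mul]
          _ ≤ C₁ + C * K := add_le_add (hC₁ n) hsum
          _ ≤ (K + 1) * C := by linarith
      exact le_of_mul_le_mul_left hle (by positivity)

end IsPowerBounded

/-! ### Frobenius series and the pair they form -/

/-- The solution of the Frobenius recursion; the coefficient is `0` where `p n = 0`, `n ≠ 0`. -/
noncomputable def frobeniusCoeff (p r b : ℕ → ℂ) (c₀ : ℂ) : ℕ → ℂ
  | n => if n = 0 then c₀ else
      (r n - ∑ i : Fin n, frobeniusCoeff p r b c₀ i * b (n - i)) / p n

lemma frobeniusCoeff_zero (p r b : ℕ → ℂ) (c₀ : ℂ) : frobeniusCoeff p r b c₀ 0 = c₀ := by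
  rw [frobeniusCoeff, if_pos rfl]

lemma frobeniusCoeff_rec {p r b : ℕ → ℂ} {c₀ : ℂ} {n : ℕ} (hn : n ≠ 0) (hp : p n ≠ 0) :
    p n * frobeniusCoeff p r b c₀ n
      + ∑ i ∈ Finset.range n, frobeniusCoeff p r b c₀ i * b (n - i) = r n := by
  rw [frobeniusCoeff, if_neg hn, mul_div_cancel₀ _ hp,
    ← Fin.sum_univ_eq_sum_range (fun i => frobeniusCoeff p r b c₀ i * b (n - i))]
  ring

/-- A coefficient depends only on the r n up to its own index. Hence a forcing that starts at the
resonance d leaves the obstruction of the homogeneous recursion unchanged. -/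
lemma frobeniusCoeff_congr {p r r' b : ℕ → ℂ} {c₀ : ℂ} {d : ℕ} (h : ∀ n < d, r n = r' n) :
    ∀ n < d, frobeniusCoeff p r b c₀ n = frobeniusCoeff p r' b c₀ n := by
  intro n
  induction n using Nat.strong_induction_on with
  | _ n ih =>
    intro hn
    rw [frobeniusCoeff, frobeniusCoeff, h n hn]
    congr 3
    exact Finset.sum_congr rfl fun i _ => by rw [ih i i.2 (i.2.trans hn)]

/-- The Frobenius series `z ^ s ∑ c n z ^ n` in the coordinate `ζ = log z`. -/
noncomputable def frobeniusSeries (s : ℂ) (c : ℕ → ℂ) (ζ : ℂ) : ℂ :=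
  exp (s * ζ) * powerSum c (exp ζ)

lemma IsPowerBounded.hasDerivAt_frobeniusSeries {c : ℕ → ℂ} {R : ℝ} (hc : IsPowerBounded c R)
    (s : ℂ) {ζ : ℂ} (hζ : ‖exp ζ‖ < R) :
    HasDerivAt (frobeniusSeries s c) (frobeniusSeries s (fun n => (n + s) * c n) ζ) ζ := by
  have h1 : HasDerivAt (fun x : ℂ => exp (s * x)) _ ζ := ((hasDerivAt_id ζ).const_mul s).cexp
  refine (h1.mul (hc.hasDerivAt_powerSum_exp hζ)).congr_deriv ?_
  have e : powerSum (fun n => (n + s) * c n) (exp ζ)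
      = powerSum (fun n => n * c n) (exp ζ) + s * powerSum c (exp ζ) := by
    simp only [_root_.add_mul]
    rw [hc.nat_mul.powerSum_add (hc.const_mul s) hζ, IsPowerBounded.powerSum_const_mul]
  rw [frobeniusSeries, e]
  simp only [id]
  ring

/-- The second derivative of a Frobenius series whose coefficients satisfy the recursion. -/
lemma frobeniusSeries_second {b c r : ℕ → ℂ} {R : ℝ} {s : ℂ} (hb : IsPowerBounded b R)
    (hb0 : b 0 = 0) (hc : IsPowerBounded c R) (hr : IsPowerBounded r R)
    (h : ∀ n : ℕ, n * (n + 2 * s) * c n + ∑ i ∈ Finset.range n, c i * b (n - i) = r n)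
    {ζ : ℂ} (hζ : ‖exp ζ‖ < R) :
    frobeniusSeries s (fun n => (n + s) * ((n + s) * c n)) ζ
      = (s ^ 2 - powerSum b (exp ζ)) * frobeniusSeries s c ζ + frobeniusSeries s r ζ := by
  have e1 : (fun n : ℕ => (n + s) * ((n + s) * c n))
      = fun n => (s ^ 2 * c n + r n) + -1 * ∑ i ∈ Finset.range n, c i * b (n - i) := by
    funext n
    linear_combination h n
  -- The bound for the convolution is read off from the recursion.
  have hconv : IsPowerBounded (fun n => ∑ i ∈ Finset.range n, c i * b (n - i)) R := by
    have e2 : (fun n => ∑ i ∈ Finset.range n, c i * b (n - i))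
        = fun n => r n + -1 * (n * ((n + 2 * s) * c n)) := by
      funext n
      linear_combination h n
    rw [e2]
    exact hr.add ((hc.add_mul _).nat_mul.const_mul _)
  rw [frobeniusSeries, frobeniusSeries, frobeniusSeries, e1,
    ((hc.const_mul _).add hr).powerSum_add (hconv.const_mul _) hζ,
    (hc.const_mul _).powerSum_add hr hζ, IsPowerBounded.powerSum_const_mul,
    IsPowerBounded.powerSum_const_mul, hc.powerSum_mul hb hb0 hζ]
  ring

lemma frobeniusSeries_add_two_pi (s : ℂ) (c : ℕ → ℂ) (ζ : ℂ) :
    frobeniusSeries s c (ζ + 2 * Real.pi * I)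
      = exp (2 * Real.pi * I * s) * frobeniusSeries s c ζ := by
  rw [frobeniusSeries, frobeniusSeries, exp_add ζ, exp_two_pi_mul_I, mul_one, mul_add, exp_add,
    mul_comm s (2 * Real.pi * I)]
  ring

lemma wronskian_const {R : ℝ} {V v₁ dv₁ v₂ dv₂ : ℂ → ℂ}
    (h₁ : ∀ ζ, exp ζ ∈ puncturedDisk R → HasDerivAt v₁ (dv₁ ζ) ζ ∧ HasDerivAt dv₁ (V ζ * v₁ ζ) ζ)
    (h₂ : ∀ ζ, exp ζ ∈ puncturedDisk R → HasDerivAt v₂ (dv₂ ζ) ζ ∧ HasDerivAt dv₂ (V ζ * v₂ ζ) ζ)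
    {x y : ℂ} (hx : exp x ∈ puncturedDisk R) (hy : exp y ∈ puncturedDisk R) :
    v₁ x * dv₂ x - dv₁ x * v₂ x = v₁ y * dv₂ y - dv₁ y * v₂ y := by
  have hR : 0 < R := hx.1.trans hx.2
  have hset : {ζ : ℂ | exp ζ ∈ puncturedDisk R} = {ζ : ℂ | ζ.re < Real.log R} := by
    ext ζ
    change (0 < ‖exp ζ‖ ∧ ‖exp ζ‖ < R) ↔ ζ.re < Real.log R
    rw [norm_exp, Real.lt_log_iff_exp_lt hR]
    exact and_iff_right (Real.exp_pos _)
  have hder : ∀ ζ ∈ {ζ : ℂ | exp ζ ∈ puncturedDisk R},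
      HasDerivAt (fun ζ => v₁ ζ * dv₂ ζ - dv₁ ζ * v₂ ζ) 0 ζ := by
    intro ζ hζ
    obtain ⟨a1, a2⟩ := h₁ ζ hζ
    obtain ⟨a3, a4⟩ := h₂ ζ hζ
    refine ((a1.mul a4).sub (a2.mul a3)).congr_deriv ?_
    ring
  have hopen : IsOpen {ζ : ℂ | exp ζ ∈ puncturedDisk R} :=
    (isOpen_puncturedDisk R).preimage Complex.continuous_exp
  refine hopen.is_const_of_deriv_eq_zero ?_
    (fun ζ hζ => (hder ζ hζ).differentiableAt.differentiableWithinAt)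
    (fun ζ hζ => (hder ζ hζ).deriv) hx hy
  rw [hset]
  exact (convex_halfSpace_re_lt _).isPreconnected

/-- The pair `v₁ = z ^ s ∑ c n z ^ n`, `v₂ = A log z v₁ + z ^ (-s) ∑ k n z ^ n` of solutions. -/
theorem isDevelopingPair_frobenius {φ : ℂ → ℂ} {R : ℝ} (hR : 0 < R) {b c k r : ℕ → ℂ} {s A L : ℂ}
    {M : GL (Fin 2) ℂ} (hb : IsPowerBounded b R) (hb0 : b 0 = 0)
    (hφ : ∀ z ∈ puncturedDisk R, z ^ 2 * φ z / 2 - (1 / 4 - s ^ 2) = powerSum b z)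
    (hc : ∀ n : ℕ, n * (n + 2 * s) * c n + ∑ i ∈ Finset.range n, c i * b (n - i) = 0)
    (hk : ∀ n : ℕ, n * (n + 2 * -s) * k n + ∑ i ∈ Finset.range n, k i * b (n - i) = r n)
    (hr : IsPowerBounded r R)
    (hrc : ∀ ζ, exp ζ ∈ puncturedDisk R → frobeniusSeries (-s) r ζ
      = -2 * A * frobeniusSeries s (fun n => (n + s) * c n) ζ)
    (hL : Tendsto (fun t : ℝ => A * exp (2 * s * t)) atBot (𝓝 L))
    (hc0 : c 0 = 1) (hne : L - 2 * s * k 0 ≠ 0)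
    (hM : ∀ ζ, exp ζ ∈ puncturedDisk R →
      (A * ζ * frobeniusSeries s c ζ + frobeniusSeries (-s) k ζ ≠ 0 ∨ frobeniusSeries s c ζ ≠ 0) →
      toSphere (A * (ζ + 2 * Real.pi * I) * frobeniusSeries s c (ζ + 2 * Real.pi * I)
        + frobeniusSeries (-s) k (ζ + 2 * Real.pi * I)) (frobeniusSeries s c (ζ + 2 * Real.pi * I))
      = M • toSphere (A * ζ * frobeniusSeries s c ζ + frobeniusSeries (-s) k ζ)
        (frobeniusSeries s c ζ)) :
    ∃ v₁ dv₁ v₂ dv₂ : ℂ → ℂ, IsDevelopingPair φ R v₁ dv₁ v₂ dv₂ M := by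
  have hz : IsPowerBounded (fun _ => 0) R := fun ρ _ _ => ⟨0, by simp⟩
  have hcb : IsPowerBounded c R := .of_recursion hb hz hc
  have hkb : IsPowerBounded k R := .of_recursion hb hr hk
  set v₁ := frobeniusSeries s c with hv₁
  set dv₁ := frobeniusSeries s (fun n => (n + s) * c n) with hdv₁
  set w := frobeniusSeries (-s) k with hw
  set dw := frobeniusSeries (-s) (fun n => (n + -s) * k n) with hdw
  have hz0 : ∀ ζ, frobeniusSeries s (fun _ => 0) ζ = 0 := fun ζ => by
    simp [frobeniusSeries, powerSum]
  have d₁ : ∀ ζ, exp ζ ∈ puncturedDisk R → HasDerivAt v₁ (dv₁ ζ) ζ ∧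
      HasDerivAt dv₁ ((1 / 4 - exp ζ ^ 2 * φ (exp ζ) / 2) * v₁ ζ) ζ := by
    intro ζ hζ
    refine ⟨hcb.hasDerivAt_frobeniusSeries s hζ.2,
      ((hcb.add_mul s).hasDerivAt_frobeniusSeries s hζ.2).congr_deriv ?_⟩
    rw [frobeniusSeries_second hb hb0 hcb hz hc hζ.2, hz0, ← hφ _ hζ]
    ring
  have d₂ : ∀ ζ, exp ζ ∈ puncturedDisk R →
      HasDerivAt (fun ζ => A * ζ * v₁ ζ + w ζ) (A * v₁ ζ + A * ζ * dv₁ ζ + dw ζ) ζ ∧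
      HasDerivAt (fun ζ => A * v₁ ζ + A * ζ * dv₁ ζ + dw ζ)
        ((1 / 4 - exp ζ ^ 2 * φ (exp ζ) / 2) * (A * ζ * v₁ ζ + w ζ)) ζ := by
    intro ζ hζ
    obtain ⟨e1, e2⟩ := d₁ ζ hζ
    have e3 : HasDerivAt w (dw ζ) ζ := hkb.hasDerivAt_frobeniusSeries (-s) hζ.2
    have e4 : HasDerivAt dw _ ζ := (hkb.add_mul (-s)).hasDerivAt_frobeniusSeries (-s) hζ.2
    have e5 : HasDerivAt (fun ζ : ℂ => A * ζ) A ζ := by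
      simpa using (hasDerivAt_id ζ).const_mul A
    constructor
    · exact ((e5.mul e1).add e3)
    -- Differentiating A ζ v₁ twice leaves an extra 2 A v₁', which the forcing r cancels by `hrc`.
    · refine (((e1.const_mul A).add (e5.mul e2)).add e4).congr_deriv ?_
      rw [frobeniusSeries_second hb hb0 hkb hr hk hζ.2, hrc ζ hζ, ← hφ _ hζ]
      ring
  have hW : ∀ ζ, exp ζ ∈ puncturedDisk R →
      v₁ ζ * (A * v₁ ζ + A * ζ * dv₁ ζ + dw ζ) - dv₁ ζ * (A * ζ * v₁ ζ + w ζ) ≠ 0 := by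
    have hexp : Tendsto (fun t : ℝ => exp (t : ℂ)) atBot (𝓝 0) := by
      rw [tendsto_zero_iff_norm_tendsto_zero]
      simpa [norm_exp] using Real.tendsto_exp_atBot
    have T : ∀ {u : ℕ → ℂ}, IsPowerBounded u R →
        Tendsto (fun t : ℝ => powerSum u (exp (t : ℂ))) atBot (𝓝 (u 0)) :=
      fun hu => (hu.tendsto_powerSum hR).comp hexp
    -- The Wronskian is constant, so its limit as z → 0 along real ζ decides. The A ζ terms cancel;
    -- A v₁² tends to L, and the v₁, w part to -2 s k 0.
    have hlim : Tendsto (fun t : ℝ => v₁ t * (A * v₁ t + A * t * dv₁ t + dw t)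
        - dv₁ t * (A * t * v₁ t + w t)) atBot (𝓝 (L - 2 * s * k 0)) := by
      have := ((hL.mul ((T hcb).mul (T hcb))).add ((T hcb).mul (T (hkb.add_mul (-s))))).sub
        ((T (hcb.add_mul s)).mul (T hkb))
      convert! this using 2
      · rename_i t
        have e1 : exp (2 * s * t) = exp (s * t) * exp (s * t) := by rw [← exp_add]; ring_nf
        have e2 : exp (-s * t) * exp (s * t) = 1 := by rw [← exp_add]; simp
        simp only [hv₁, hdv₁, hw, hdw, frobeniusSeries]
        rw [e1]
        linear_combination (powerSum c (exp t) * powerSum (fun n => (n + -s) * k n) (exp t)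
          - powerSum (fun n => (n + s) * c n) (exp t) * powerSum k (exp t)) * e2
      · rw [hc0]; push_cast; ring
    intro ζ hζ h0
    refine hne (tendsto_nhds_unique hlim (tendsto_const_nhds.congr' ?_))
    have hev : ∀ᶠ t : ℝ in atBot, exp (t : ℂ) ∈ puncturedDisk R := by
      filter_upwards [eventually_lt_atBot (Real.log R)] with t ht
      refine ⟨norm_pos_iff.2 (exp_ne_zero _), ?_⟩
      rw [norm_exp, ofReal_re]
      exact (Real.lt_log_iff_exp_lt hR).1 ht
    filter_upwards [hev] with t ht
    rw [← h0]
    exact wronskian_const (V := fun ζ => 1 / 4 - exp ζ ^ 2 * φ (exp ζ) / 2) d₁ d₂ hζ ht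
  refine ⟨v₁, dv₁, fun ζ => A * ζ * v₁ ζ + w ζ, fun ζ => A * v₁ ζ + A * ζ * dv₁ ζ + dw ζ, d₁, d₂,
    hW, fun ζ hζ => hM ζ hζ ?_⟩
  by_contra! h
  refine hW ζ hζ ?_
  rw [h.1, h.2]
  ring

lemma IsPowerBounded.shift {c : ℕ → ℂ} {R : ℝ} (hc : IsPowerBounded c R) (d : ℕ) :
    IsPowerBounded (fun n => if n < d then 0 else c (n - d)) R := by
  intro ρ h0 h
  obtain ⟨C, hC⟩ := hc ρ h0 h
  have hC0 : 0 ≤ C := le_trans (by positivity) (hC 0)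
  refine ⟨C * ρ ^ d, fun n => ?_⟩
  by_cases hn : n < d
  · simp only [hn, if_true, norm_zero, zero_mul]; positivity
  · simp only [hn, if_false]
    have e : ρ ^ n = ρ ^ (n - d) * ρ ^ d := by rw [← pow_add, Nat.sub_add_cancel (not_lt.1 hn)]
    rw [e, ← mul_assoc]
    have := hC (n - d)
    gcongr

lemma IsPowerBounded.powerSum_shift {c : ℕ → ℂ} {R : ℝ} (hc : IsPowerBounded c R) (d : ℕ) {z : ℂ}
    (hz : ‖z‖ < R) :
    powerSum (fun n => if n < d then 0 else c (n - d)) z = z ^ d * powerSum c z := by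
  rw [powerSum, ← ((hc.shift d).summable hz).sum_add_tsum_nat_add d, Finset.sum_eq_zero, zero_add,
    powerSum, ← tsum_mul_left]
  · refine tsum_congr fun n => ?_
    simp [pow_add]
    ring
  · intro i hi
    simp [Finset.mem_range.1 hi]

/-! ### The determinant and the resonance; Taylor series on the full disk -/

/-- The determinant of `coeffMatrix` vanishes if and only if the Frobenius recursion for the smaller
exponent can be continued past the resonance at `d`. -/
lemma coeffMatrix_det_eq_zero_iff {a : ℕ → ℂ} {d : ℕ} (hd : 1 ≤ d) {k : ℕ → ℂ} (hk0 : k 0 = 1)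
    (hk : ∀ n, 1 ≤ n → n < d → n * (n - d) * k n
      + ∑ i ∈ Finset.range n, k i * (a (n - i) / 2) = 0) :
    (coeffMatrix a d).det = 0 ↔ ∑ i ∈ Finset.range d, k i * (a (d - i) / 2) = 0 := by
  -- Row i is twice the recursion at index i + 1. In the last row the factor i + 1 - d is zero, so
  -- the entry x d outside the vector does not count.
  have hrow : ∀ (x : ℕ → ℂ) (i : Fin d), (coeffMatrix a d).mulVec (fun j => x j) i
      = 2 * (∑ j ∈ Finset.range ((i : ℕ) + 1), x j * (a ((i : ℕ) + 1 - j) / 2)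
        + ((i : ℂ) + 1) * ((i : ℂ) + 1 - d) * x (i + 1)) := by
    intro x i
    have e : (coeffMatrix a d).mulVec (fun j => x j) i
        = ∑ j ∈ Finset.range d, (if j ≤ i then a ((i : ℕ) - j + 1)
          else if j = i + 1 then 2 * ((i : ℂ) + 1) * ((i : ℂ) + 1 - d) else 0) * x j := by
      rw [Matrix.mulVec, dotProduct, ← Fin.sum_univ_eq_sum_range]
      rfl
    have hi := i.2
    have hsub : ∑ j ∈ Finset.range ((i : ℕ) + 1), (if j ≤ (i : ℕ) then a ((i : ℕ) - j + 1)
          else if j = i + 1 then 2 * ((i : ℂ) + 1) * ((i : ℂ) + 1 - d) else 0) * x j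
        = 2 * ∑ j ∈ Finset.range ((i : ℕ) + 1), x j * (a ((i : ℕ) + 1 - j) / 2) := by
      rw [Finset.mul_sum]
      refine Finset.sum_congr rfl fun j hj => ?_
      have hj' := Nat.lt_succ_iff.1 (Finset.mem_range.1 hj)
      rw [if_pos hj', Nat.sub_add_comm hj']
      ring
    rw [e, mul_add 2 (Finset.sum _ _), ← hsub]
    rcases lt_or_ge ((i : ℕ) + 1) d with h | h
    · have hz : ∀ j ∈ Finset.range d, j ∉ Finset.range ((i : ℕ) + 1 + 1) →
          (if j ≤ (i : ℕ) then a ((i : ℕ) - j + 1)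
          else if j = i + 1 then 2 * ((i : ℂ) + 1) * ((i : ℂ) + 1 - d) else 0) * x j = 0 := by
        intro j _ hj
        have : (i : ℕ) + 1 + 1 ≤ j := by simpa using hj
        rw [if_neg (by omega), if_neg (by omega), zero_mul]
      rw [← Finset.sum_subset (Finset.range_mono (show (i : ℕ) + 1 + 1 ≤ d by omega)) hz,
        Finset.sum_range_succ _ ((i : ℕ) + 1), if_neg (by omega), if_pos rfl]
      ring
    · have hid : (i : ℕ) + 1 = d := le_antisymm hi h
      have : (i : ℂ) + 1 = d := by exact_mod_cast hid
      rw [this, sub_self, hid]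
      ring
  constructor
  · intro h0
    obtain ⟨y, hy0, hy⟩ := Matrix.exists_mulVec_eq_zero_iff.2 h0
    obtain ⟨x, rfl⟩ : ∃ x : ℕ → ℂ, (fun j : Fin d => x j) = y :=
      ⟨fun j => if h : j < d then y ⟨j, h⟩ else 0, by funext j; simp⟩
    -- The superdiagonal entries are nonzero, so all rows but the last determine a kernel vector
    -- from x 0; the last row then states the obstruction.
    have hx : ∀ n < d, x n = x 0 * k n := by
      intro n
      induction n using Nat.strong_induction_on with
      | _ n ih =>
        intro hn
        rcases n with _ | n
        · rw [hk0, mul_one]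
        · have h1 := congrFun hy ⟨n, by omega⟩
          rw [hrow] at h1
          have h2 : ∑ j ∈ Finset.range (n + 1), x j * (a (n + 1 - j) / 2)
              = x 0 * ∑ j ∈ Finset.range (n + 1), k j * (a (n + 1 - j) / 2) := by
            rw [Finset.mul_sum]
            refine Finset.sum_congr rfl fun j hj => ?_
            have hj' := Finset.mem_range.1 hj
            rw [ih j hj' (by omega)]
            ring
          have h3 := hk (n + 1) (by omega) hn
          have hne : ((n : ℂ) + 1) * ((n : ℂ) + 1 - d) ≠ 0 := by
            refine mul_ne_zero (by exact_mod_cast n.succ_ne_zero) (sub_ne_zero.2 ?_)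
            exact_mod_cast hn.ne
          push_cast at h1 h3
          simp only [Pi.zero_apply] at h1
          rw [h2] at h1
          refine mul_left_cancel₀ hne ?_
          linear_combination h1 / 2 - x 0 * h3
    have hx0 : x 0 ≠ 0 := by
      intro h
      apply hy0
      funext j
      rw [hx j j.2, h, zero_mul]
      rfl
    have h1 := congrFun hy ⟨d - 1, by omega⟩
    rw [hrow] at h1
    simp only [Nat.sub_add_cancel hd, Pi.zero_apply] at h1
    have h2 : ∑ j ∈ Finset.range d, x j * (a (d - j) / 2)
        = x 0 * ∑ j ∈ Finset.range d, k j * (a (d - j) / 2) := by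
      rw [Finset.mul_sum]
      refine Finset.sum_congr rfl fun j hj => ?_
      rw [hx j (Finset.mem_range.1 hj)]
      ring
    have h3 : ((d - 1 : ℕ) : ℂ) + 1 = d := by exact_mod_cast Nat.sub_add_cancel hd
    rw [h2, h3, sub_self, mul_zero, zero_mul, add_zero] at h1
    simpa [hx0] using h1
  · intro h
    refine Matrix.exists_mulVec_eq_zero_iff.1 ⟨fun j => k j, ?_, ?_⟩
    · intro h0
      have := congrFun h0 ⟨0, by omega⟩
      simp [hk0] at this
    · funext i
      rw [hrow, Pi.zero_apply]
      rcases lt_or_ge ((i : ℕ) + 1) d with h' | h'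
      · have := hk (i + 1) (by omega) h'
        push_cast at this
        linear_combination 2 * this
      · have hid : (i : ℕ) + 1 = d := le_antisymm i.2 h'
        have h3 : (i : ℂ) + 1 = d := by exact_mod_cast hid
        rw [h3, hid, h]
        ring

lemma toSphere_mul_left {c : ℂ} (hc : c ≠ 0) (P Q : ℂ) :
    toSphere (c * P) (c * Q) = toSphere P Q := by
  simp only [toSphere, mul_eq_zero, hc, false_or, mul_div_mul_left _ _ hc]

/-- The Taylor series at `0` of a function holomorphic on a disk converges on that disk. -/
lemma isPowerBounded_of_differentiableOn {f : ℂ → ℂ} {b : ℕ → ℂ} {R : ℝ}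
    (hf : DifferentiableOn ℂ f (Metric.ball 0 R))
    (hb : ∀ᶠ z in 𝓝 0, HasSum (fun n => b n * z ^ n) (f z)) :
    IsPowerBounded b R ∧ ∀ z ∈ Metric.ball 0 R, f z = powerSum b z := by
  have hat : HasFPowerSeriesAt f (FormalMultilinearSeries.ofScalars ℂ b) 0 := by
    rw [hasFPowerSeriesAt_iff]
    filter_upwards [hb] with z hz
    simpa [FormalMultilinearSeries.coeff_ofScalars, mul_comm] using hz
  have hball : ∀ r : ℝ, 0 < r → r < R →
      HasFPowerSeriesOnBall f (FormalMultilinearSeries.ofScalars ℂ b) 0 (ENNReal.ofReal r) := by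
    intro r h0 h
    have h1 : DifferentiableOn ℂ f (Metric.closedBall 0 (r.toNNReal : ℝ)) := by
      refine hf.mono (Metric.closedBall_subset_ball ?_)
      rwa [Real.coe_toNNReal _ h0.le]
    have h2 := h1.hasFPowerSeriesOnBall (Real.toNNReal_pos.2 h0)
    -- By uniqueness of power series, the Cauchy series on each smaller disk has the coefficients b.
    rwa [h2.hasFPowerSeriesAt.eq_formalMultilinearSeries hat] at h2
  constructor
  · intro ρ h0 hρ
    obtain ⟨r, h1, h2⟩ := exists_between hρ
    have hr := (hball r (h0.trans_lt h1) h2).r_le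
    have hs := FormalMultilinearSeries.summable_norm_mul_pow
      (FormalMultilinearSeries.ofScalars ℂ b) (r := ρ.toNNReal) (lt_of_lt_of_le
        (by simpa [ENNReal.ofReal] using (Real.toNNReal_lt_toNNReal_iff (h0.trans_lt h1)).2 h1) hr)
    simp only [FormalMultilinearSeries.norm_apply_eq_norm_coef,
      FormalMultilinearSeries.coeff_ofScalars, Real.coe_toNNReal _ h0] at hs
    exact ⟨_, fun n => hs.le_tsum n fun _ _ => by positivity⟩
  · intro z hz
    rw [mem_ball_zero_iff] at hz
    obtain ⟨r, h1, h2⟩ := exists_between hz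
    have h0 := (norm_nonneg z).trans_lt h1
    have := (hball r h0 h2).hasSum (y := z) (by
      rw [Metric.eball_ofReal]
      simpa using h1)
    simp only [FormalMultilinearSeries.apply_eq_pow_smul_coeff,
      FormalMultilinearSeries.coeff_ofScalars, zero_add, smul_eq_mul] at this
    rw [← this.tsum_eq, powerSum]
    exact tsum_congr fun n => mul_comm _ _

/-! ### The potential and its two kinds of developing pair -/

section

variable {φ : ℂ → ℂ} {δ : ℂ} {a : ℕ → ℂ} {R : ℝ}

/-- The coefficients of `z² φ(z) / 2 - (1 - δ²) / 4`. -/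
noncomputable def potentialCoeff (a : ℕ → ℂ) (n : ℕ) : ℂ := if n = 0 then 0 else a n / 2

/-- Multiplying by z²/2 removes the pole, so the function extends holomorphically across 0. Its
series, known only near 0 from `hexp`, then converges on the whole disk of radius R. -/
lemma potentialCoeff_expansion
    (hexp : ∀ᶠ z in 𝓝[≠] (0 : ℂ),
      HasSum (fun n : ℕ => a (n + 1) * z ^ ((n : ℤ) - 1)) (φ z - (1 - δ ^ 2) / (2 * z ^ 2)))
    (hφ : DifferentiableOn ℂ φ (puncturedDisk R)) :
    IsPowerBounded (potentialCoeff a) R ∧ ∀ z ∈ puncturedDisk R,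
      z ^ 2 * φ z / 2 - (1 - δ ^ 2) / 4 = powerSum (potentialCoeff a) z := by
  classical
  set N : ℂ → ℂ := fun z => if z = 0 then 0 else z ^ 2 * φ z / 2 - (1 - δ ^ 2) / 4 with hN
  have hsum : ∀ᶠ z in 𝓝 0, HasSum (fun n => potentialCoeff a n * z ^ n) (N z) := by
    rw [eventually_nhdsWithin_iff] at hexp
    filter_upwards [hexp] with z hz
    by_cases h0 : z = 0
    · have := hasSum_single (f := fun n => potentialCoeff a n * z ^ n) 0
        (fun n hn => by simp [h0, hn])
      simpa [hN, h0, potentialCoeff] using this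
    · have h1 := (hz h0).mul_left (z ^ 2 / 2)
      rw [← hasSum_nat_add_iff' 1]
      convert! h1 using 1
      · funext n
        have e : z ^ 2 * z ^ ((n : ℤ) - 1) = z ^ (n + 1) := by
          rw [← zpow_natCast z 2, ← zpow_natCast z (n + 1), ← zpow_add₀ h0]
          congr 1
          push_cast
          ring
        simp only [potentialCoeff, Nat.succ_ne_zero, if_false]
        linear_combination -(a (n + 1) / 2) * e
      · simp only [hN, h0, if_false, Finset.sum_range_one, potentialCoeff, if_true]
        field_simp
        ring
  have hdiff : DifferentiableOn ℂ N (Metric.ball 0 R) := by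
    intro z hz
    refine DifferentiableAt.differentiableWithinAt ?_
    by_cases h0 : z = 0
    · subst h0
      have : HasFPowerSeriesAt N (FormalMultilinearSeries.ofScalars ℂ (potentialCoeff a)) 0 := by
        rw [hasFPowerSeriesAt_iff]
        filter_upwards [hsum] with z hz
        simpa [FormalMultilinearSeries.coeff_ofScalars, mul_comm] using hz
      exact this.analyticAt.differentiableAt
    · have hzU : z ∈ puncturedDisk R := ⟨norm_pos_iff.2 h0, by simpa using hz⟩
      have h1 : DifferentiableAt ℂ φ z :=
        (hφ z hzU).differentiableAt ((isOpen_puncturedDisk R).mem_nhds hzU)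
      have h2 : DifferentiableAt ℂ (fun z => z ^ 2 * φ z / 2 - (1 - δ ^ 2) / 4) z := by fun_prop
      refine h2.congr_of_eventuallyEq ?_
      filter_upwards [isOpen_ne.mem_nhds h0] with w hw
      exact if_neg hw
  obtain ⟨h1, h2⟩ := isPowerBounded_of_differentiableOn hdiff hsum
  refine ⟨h1, fun z hz => ?_⟩
  rw [← h2 z (by simpa using hz.2)]
  exact (if_neg (norm_pos_iff.1 hz.1)).symm

/-- The developing map when no resonance occurs. -/
lemma exists_developingPair_of_not_int (hR : 0 < R)
    (hb : IsPowerBounded (potentialCoeff a) R)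
    (hφ : ∀ z ∈ puncturedDisk R,
      z ^ 2 * φ z / 2 - (1 - δ ^ 2) / 4 = powerSum (potentialCoeff a) z)
    (hδ : ∀ n : ℤ, δ ≠ n) :
    ∃ v₁ dv₁ v₂ dv₂ : ℂ → ℂ, IsDevelopingPair φ R v₁ dv₁ v₂ dv₂
      (scalingGL (exp (2 * Real.pi * I * δ)) (exp_ne_zero _)) := by
  have hrec : ∀ s : ℂ, (∀ n : ℤ, 2 * s ≠ n) → ∃ c : ℕ → ℂ, c 0 = 1 ∧ ∀ n : ℕ,
      n * (n + 2 * s) * c n + ∑ i ∈ Finset.range n, c i * potentialCoeff a (n - i) = 0 := by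
    intro s hs
    refine ⟨frobeniusCoeff (fun n => n * (n + 2 * s)) 0 (potentialCoeff a) 1,
      frobeniusCoeff_zero _ _ _ _, fun n => ?_⟩
    rcases eq_or_ne n 0 with rfl | hn
    · simp
    · refine frobeniusCoeff_rec (p := fun n => n * (n + 2 * s)) (r := 0) hn
        (mul_ne_zero (by exact_mod_cast hn) fun h => hs (-n) ?_)
      push_cast
      linear_combination h
  -- The exponent -δ/2 goes to the denominator v₁, so that the quotient behaves like z^δ and not
  -- z^(-δ).
  obtain ⟨c, hc0, hc⟩ := hrec (-δ / 2) fun n h => hδ (-n) (by push_cast; linear_combination -h)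
  obtain ⟨k, hk0, hk⟩ := hrec (-(-δ / 2)) fun n h => hδ n (by linear_combination h)
  refine isDevelopingPair_frobenius hR (A := 0) (L := 0) hb (if_pos rfl) (fun z hz => ?_) hc hk
    (fun ρ _ _ => ⟨0, by simp⟩) (fun ζ _ => ?_) (by simp) hc0 ?_ (fun ζ hζ hne => ?_)
  · rw [← hφ z hz]; ring
  · simp [frobeniusSeries, powerSum]
  · rw [hk0]
    have := hδ 0
    push_cast at this
    intro h
    exact this (by linear_combination h)
  · rw [scalingGL_smul _ _ _ hne, frobeniusSeries_add_two_pi, frobeniusSeries_add_two_pi,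
      ← toSphere_mul_left (exp_ne_zero (2 * Real.pi * I * (-δ / 2))) (exp _ * _)]
    have e : exp (2 * Real.pi * I * -(-δ / 2))
        = exp (2 * Real.pi * I * (-δ / 2)) * exp (2 * Real.pi * I * δ) := by
      rw [← exp_add]; ring_nf
    rw [e]
    ring_nf

/-- The developing map in the resonant case; `A` is the coefficient of the logarithm. -/
lemma exists_developingPair_of_nat (hR : 0 < R)
    (hb : IsPowerBounded (potentialCoeff a) R) {d : ℕ}
    (hφ : ∀ z ∈ puncturedDisk R,
      z ^ 2 * φ z / 2 - (1 - (d : ℂ) ^ 2) / 4 = powerSum (potentialCoeff a) z) :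
    ∃ (A : ℂ) (v₁ dv₁ v₂ dv₂ : ℂ → ℂ), IsDevelopingPair φ R v₁ dv₁ v₂ dv₂
      (translationGL (2 * Real.pi * I * A)) ∧ (d = 0 → A ≠ 0) ∧
      (1 ≤ d → (A = 0 ↔ (coeffMatrix a d).det = 0)) := by
  set b := potentialCoeff a with hbdef
  set s : ℂ := d / 2 with hs
  have hp1 : ∀ n : ℕ, n ≠ 0 → (n : ℂ) * (n + 2 * s) ≠ 0 := by
    intro n hn
    rw [hs, mul_div_cancel₀ _ two_ne_zero]
    exact_mod_cast Nat.mul_ne_zero hn (by omega)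
  have hp2 : ∀ n : ℕ, n ≠ 0 → n ≠ d → (n : ℂ) * (n + 2 * -s) ≠ 0 := by
    intro n hn hnd
    refine mul_ne_zero (by exact_mod_cast hn) fun h => hnd ?_
    have : (n : ℂ) = d := by rw [hs] at h; linear_combination h
    exact_mod_cast this
  obtain ⟨c, hc0, hc⟩ : ∃ c : ℕ → ℂ, c 0 = 1 ∧ ∀ n : ℕ,
      n * (n + 2 * s) * c n + ∑ i ∈ Finset.range n, c i * b (n - i) = 0 := by
    refine ⟨frobeniusCoeff (fun n => n * (n + 2 * s)) 0 b 1, frobeniusCoeff_zero _ _ _ _,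
      fun n => ?_⟩
    rcases eq_or_ne n 0 with rfl | hn
    · simp
    · exact frobeniusCoeff_rec (p := fun n => n * (n + 2 * s)) (r := 0) hn (hp1 n hn)
  set p : ℕ → ℂ := fun n => n * (n + 2 * -s) with hp
  set S := ∑ i ∈ Finset.range d, frobeniusCoeff p 0 b 1 i * b (d - i) with hS
  -- For d ≥ 1 the recursion at n = d reads S = r d = -A d, which forces A. For d = 0 the logarithm
  -- is normalised to coefficient 1.
  set A : ℂ := if d = 0 then 1 else -S / d with hA
  -- The shift by d converts the exponent s of -2 A v₁' to -s, because 2s = d.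
  set r : ℕ → ℂ := fun n => if n < d then 0 else -2 * A * (((n - d : ℕ) + s) * c (n - d)) with hr
  -- The initial value makes the Wronskian 1 for d = 0 and -d otherwise. For d ≥ 1 the coefficient k
  -- d is free; division by zero sets it to 0.
  set k := frobeniusCoeff p r b (if d = 0 then 0 else 1) with hkdef
  have hz : IsPowerBounded (fun _ => 0) R := fun ρ _ _ => ⟨0, by simp⟩
  have hcb : IsPowerBounded c R := .of_recursion hb hz hc
  have hk : ∀ n : ℕ, n * (n + 2 * -s) * k n + ∑ i ∈ Finset.range n, k i * b (n - i) = r n := by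
    intro n
    rcases eq_or_ne n 0 with rfl | hn
    · rcases Nat.eq_zero_or_pos d with hd | hd
      · simp [hr, hd, hs]
      · simp [hr, hd]
    · by_cases hnd : n = d
      · subst hnd
        have e1 : ∑ i ∈ Finset.range n, k i * b (n - i) = S := by
          refine Finset.sum_congr rfl fun i hi => ?_
          rw [hkdef, if_neg hn, frobeniusCoeff_congr (r' := 0) (d := n) (fun m hm => ?_) i
            (Finset.mem_range.1 hi)]
          simp [hr, hm]
        have hn' : (n : ℂ) ≠ 0 := by exact_mod_cast hn
        rw [e1]
        simp only [hr, lt_irrefl, if_false, Nat.sub_self, hc0, hA, hn, hs]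
        push_cast
        field_simp
        ring
      · exact frobeniusCoeff_rec (p := p) hn (hp2 n hn hnd)
  have hb0 : b 0 = 0 := if_pos rfl
  refine ⟨A, ?_⟩
  have hpair := isDevelopingPair_frobenius (φ := φ) hR (A := A) (L := if d = 0 then 1 else 0)
    (M := translationGL (2 * Real.pi * I * A)) hb hb0
    (fun z hz => ?_) hc hk (((hcb.add_mul s).const_mul (-2 * A)).shift d) (fun ζ hζ => ?_) ?_ hc0 ?_
    (fun ζ hζ hne => ?_)
  · obtain ⟨v₁, dv₁, v₂, dv₂, h⟩ := hpair
    refine ⟨v₁, dv₁, v₂, dv₂, h, fun hd => by simp [hA, hd], fun hd => ?_⟩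
    have hd0 : d ≠ 0 := by omega
    have hd0' : (d : ℂ) ≠ 0 := by exact_mod_cast hd0
    have hab : ∀ n i, i ∈ Finset.range n → b (n - i) = a (n - i) / 2 := fun n i hi =>
      if_neg (by have := Finset.mem_range.1 hi; omega)
    rw [coeffMatrix_det_eq_zero_iff hd (frobeniusCoeff_zero p 0 b 1) fun n h1 h2 => ?_]
    · have e : ∑ i ∈ Finset.range d, frobeniusCoeff p 0 b 1 i * (a (d - i) / 2) = S :=
        Finset.sum_congr rfl fun i hi => by rw [hab d i hi]
      rw [e]
      simp [hA, hd0]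
    · have := frobeniusCoeff_rec (p := p) (r := 0) (b := b) (c₀ := 1) (show n ≠ 0 by omega)
        (hp2 n (by omega) (by omega))
      rw [Finset.sum_congr rfl fun i hi => by rw [hab n i hi]] at this
      have e : (n : ℂ) * (n - d) = n * (n + 2 * -s) := by rw [hs]; ring
      rw [e]
      exact this
  · rw [← hφ z hz, hs]; ring
  · have e : exp (-s * ζ) * exp ζ ^ d = exp (s * ζ) := by
      rw [← exp_nat_mul, ← exp_add, hs]; ring_nf
    rw [frobeniusSeries, frobeniusSeries,
      ((hcb.add_mul s).const_mul (-2 * A)).powerSum_shift d hζ.2, IsPowerBounded.powerSum_const_mul, ← e]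
    ring
  · by_cases hd : d = 0
    · simp [hA, hs, hd]
    · rw [if_neg hd, ← mul_zero A]
      refine tendsto_const_nhds.mul ?_
      rw [tendsto_zero_iff_norm_tendsto_zero]
      have h1 : Tendsto (fun t : ℝ => (d : ℝ) * t) atBot atBot :=
        tendsto_id.const_mul_atBot (by exact_mod_cast Nat.pos_of_ne_zero hd)
      refine (Real.tendsto_exp_atBot.comp h1).congr fun t => ?_
      rw [norm_exp, hs, mul_div_cancel₀ _ two_ne_zero]
      simp
  · by_cases hd : d = 0
    · simp [hkdef, frobeniusCoeff_zero, hd]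
    · simp [hkdef, frobeniusCoeff_zero, hd, hs]
  -- As 2s is an integer, both series acquire the same factor, and only the logarithm changes the
  -- quotient.
  · have e : exp (2 * Real.pi * I * -s) = exp (2 * Real.pi * I * s) := by
      rw [exp_eq_exp_iff_exists_int]
      exact ⟨-d, by rw [hs]; push_cast; ring⟩
    rw [translationGL_smul _ _ _ hne, frobeniusSeries_add_two_pi, frobeniusSeries_add_two_pi, e,
      ← toSphere_mul_left (exp_ne_zero (2 * Real.pi * I * s))
        (A * ζ * frobeniusSeries s c ζ + _ + _)]
    congr 1
    ring

end

/-! ### The theorem -/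

theorem theorem3p1 (φ : ℂ → ℂ) (δ : ℂ) (a : ℕ → ℂ)
    (hexp : ∀ᶠ z in 𝓝[≠] (0 : ℂ),
      HasSum (fun n : ℕ => a (n + 1) * z ^ ((n : ℤ) - 1)) (φ z - (1 - δ ^ 2) / (2 * z ^ 2)))
    (R : ℝ) (hφ : DifferentiableOn ℂ φ (puncturedDisk R))
    (z₀ : ℂ) (hz₀ : z₀ ∈ puncturedDisk R) :
    (∃ f₀ : ℂ → OnePoint ℂ, IsSchwarzianPrimitiveAt φ f₀ z₀) ∧
    ∀ f₀ : ℂ → OnePoint ℂ, IsSchwarzianPrimitiveAt φ f₀ z₀ →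
      (∀ p : Path z₀ z₀, (∀ t, p t ∈ puncturedDisk R) →
        ∃! γ : moebiusGroup, IsHolonomyAlong f₀ p γ) ∧
      ∃ γ : moebiusGroup,
        IsHolonomyAlong f₀ (circleLoop z₀) γ ∧
        holonomySet (puncturedDisk R) z₀ f₀ = (Subgroup.zpowers γ : Set moebiusGroup) ∧
        ((∀ n : ℤ, δ ≠ n) →
          γ ≠ 1 ∧ IsConjToScaling γ (Complex.exp (2 * Real.pi * Complex.I * δ)) ∧
          (IsEllipticMoebius γ ↔ δ.im = 0) ∧ (IsLoxodromicMoebius γ ↔ δ.im ≠ 0)) ∧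
        (δ = 0 → IsParabolicMoebius γ) ∧
        (∀ d : ℕ, 1 ≤ d → (δ = d ∨ δ = -d) →
          (IsParabolicMoebius γ ∨ γ = 1) ∧ (γ = 1 ↔ (coeffMatrix a d).det = 0)) := by
  have hR : 0 < R := hz₀.1.trans hz₀.2
  obtain ⟨hb, hexpn⟩ := potentialCoeff_expansion hexp hφ
  have hprim : ∀ {v₁ dv₁ v₂ dv₂ : ℂ → ℂ} {M : GL (Fin 2) ℂ},
      IsDevelopingPair φ R v₁ dv₁ v₂ dv₂ M →
        ∃ f₀ : ℂ → OnePoint ℂ, IsSchwarzianPrimitiveAt φ f₀ z₀ := by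
    intro v₁ dv₁ v₂ dv₂ M h
    have e : exp (log z₀) = z₀ := exp_log (norm_pos_iff.1 hz₀.1)
    have := h.isSchwarzianPrimitiveAt (ζ₀ := log z₀) (by rwa [e])
    rw [e] at this
    exact ⟨_, this⟩
  by_cases hδ : ∀ n : ℤ, δ ≠ n
  · obtain ⟨v₁, dv₁, v₂, dv₂, h⟩ := exists_developingPair_of_not_int hR hb hexpn hδ
    refine ⟨hprim h, fun f₀ hf₀ => ?_⟩
    obtain ⟨h1, g, h2, h3⟩ := h.holonomy hz₀ hf₀
    refine ⟨h1, _, h2, h3, fun _ => ?_, fun h0 => absurd h0 (by simpa using hδ 0), ?_⟩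
    · set lam := exp (2 * Real.pi * I * δ) with hlam
      have hconj : IsConjToScaling _ lam :=
        isConjToScaling_conj g (exp_ne_zero (2 * Real.pi * I * δ))
      generalize g * moebiusOf (scalingGL (exp (2 * Real.pi * I * δ)) (exp_ne_zero _)) * g⁻¹ = γ
        at hconj ⊢
      have hlam1 : lam ≠ 1 := by
        intro h
        obtain ⟨n, hn⟩ := exp_eq_one_iff.1 h
        refine hδ n (mul_left_cancel₀ two_pi_I_ne_zero ?_)
        rw [hn]; ring
      have hnorm : ‖lam‖ = 1 ↔ δ.im = 0 := by
        have e : (2 * Real.pi * I * δ).re = -(2 * Real.pi) * δ.im := by simp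
        rw [hlam, norm_exp, Real.exp_eq_one_iff, e]
        simp [Real.pi_ne_zero]
      -- Multipliers are unique up to inversion, so having modulus 1 is a property of γ.
      have hnorm_eq : ∀ {mu : ℂ}, IsConjToScaling γ mu → (‖mu‖ = 1 ↔ ‖lam‖ = 1) := by
        intro mu hmu
        rcases hconj.eq_or_mul_eq_one hmu with rfl | h
        · rfl
        · have : ‖lam‖ * ‖mu‖ = 1 := by rw [← norm_mul, h, norm_one]
          constructor <;> intro h' <;> rw [h'] at this <;> simpa using this
      refine ⟨fun h => hlam1 (h ▸ hconj).eq_one, hconj, ?_, ?_⟩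
      · rw [← hnorm]
        exact ⟨fun ⟨mu, h1, _, h2⟩ => (hnorm_eq h2).1 h1, fun h => ⟨lam, h, hlam1, hconj⟩⟩
      · rw [ne_eq, ← hnorm]
        exact ⟨fun ⟨mu, h1, h2⟩ h => h1 ((hnorm_eq h2).2 h), fun h => ⟨lam, h, hconj⟩⟩
    · rintro d - (h | h)
      · exact absurd h (by simpa using hδ d)
      · exact absurd h (by simpa using hδ (-d))
  · push Not at hδ
    obtain ⟨m, hm⟩ := hδ
    -- Only δ² enters the equation, so both signs are treated at once with d = |m|.
    have hδ2 : δ ^ 2 = ((m.natAbs : ℕ) : ℂ) ^ 2 := by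
      rw [hm, ← Int.cast_natCast, ← Int.cast_pow, ← Int.cast_pow, Int.natAbs_sq]
    rw [hδ2] at hexpn
    obtain ⟨A, v₁, dv₁, v₂, dv₂, h, hA0, hA⟩ := exists_developingPair_of_nat hR hb hexpn
    refine ⟨hprim h, fun f₀ hf₀ => ?_⟩
    obtain ⟨h1, g, h2, h3⟩ := h.holonomy hz₀ hf₀
    have hpar : A ≠ 0 →
        IsParabolicMoebius (g * moebiusOf (translationGL (2 * Real.pi * I * A)) * g⁻¹) :=
      fun hne => isParabolicMoebius_conj g (mul_ne_zero two_pi_I_ne_zero hne)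
    have hone : g * moebiusOf (translationGL (2 * Real.pi * I * A)) * g⁻¹ = 1 ↔ A = 0 := by
      rw [conj_eq_one_iff, moebiusOf_translationGL_eq_one_iff]
      simp
    refine ⟨h1, _, h2, h3, fun hne => absurd hm (hne m), fun h0 => hpar (hA0 ?_), ?_⟩
    · rw [hm] at h0
      rw [Int.natAbs_eq_zero]
      exact_mod_cast h0
    · intro d hd hdδ
      have hmd : m.natAbs = d := by
        have : δ ^ 2 = (d : ℂ) ^ 2 := by rcases hdδ with h | h <;> rw [h]; ring
        rw [hδ2] at this
        have h' : m.natAbs ^ 2 = d ^ 2 := by exact_mod_cast this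
        exact Nat.pow_left_injective two_ne_zero h'
      rw [hmd] at hA
      refine ⟨?_, hone.trans (hA hd)⟩
      by_cases h0 : A = 0
      · exact Or.inr (hone.2 h0)
      · exact Or.inl (hpar h0)
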